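/- Let $\Delta\ge 0$, let $V$ be a finite vertex set, and let $S_1,\dots,S_m$ be a fixed (oblivious) sequence of batches of edge insertions and deletions, starting from the empty graph on $V$, such that inserted edges are absent, deleted edges are present, and after each batch the maximum degree is at most $\Delta$. Let $T=\sum_k|S_k|$ be the total number of edge updates. Run the following randomized $(\Delta+1)$-coloring algorithm. *State.* Every vertex $u$ has a level $\ell(u)\in\{5,\dots,\lambda\}$, $\lambda=\max(5,\lceil\log_3\Delta\rceil)$, a color $\chi(u)\in\{0,\dots,\Delta\}$ (or none), and a mark $\tau_u$. Write $N_u(1,k)$ for the set of neighbors of $u$ at level at most $k$. A vertex $u$ is *clean* if $|N_u(1,\ell(u))|\le 3^{\ell(u)+2}$ (upper condition) and, in case $\ell(u)>5$, $|N_u(1,\ell(u)-1)|\ge 3^{\ell(u)-5}$ (lower condition); otherwise it is *dirty*. A color is *blank* for $u$ if no neighbor of $u$ has it, and *unique* for $u$ if no neighbor at level $\ge\ell(u)$ and exactly one neighbor at level $<\ell(u)$ has it. Initially all vertices have level $5$, independent uniform colors, and mark $(0,5)$. *Batch $S_k$, initialization.* Apply $S_k$ to the graph. For each inserted edge whose endpoints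 have the same color, uncolor the endpoint that was recolored most recently (both in case of a tie). Here the mark $\mathrm{det}$ counts as most recent; among marks $(k,i)$ a larger batch number $k$ is more recent, and inside a batch a lower level $i$ is more recent, since levels are colored top-down. *Coloring.* For $i=\lambda,\dots,5$, first color the uncolored dirty vertices of level $i$, then the uncolored clean ones. Each of the two steps runs in rounds until none is left. In a round, with $H$ the subgraph induced on the vertices still to be colored in this step, every vertex of $H$ independently proposes a uniform color from its palette and keeps it if no neighbor in $H$ proposed the same color. Dirty $u$: the palette initially consists of $\deg_H(u)+1$ blank colors, colors kept by neighbors are removed from it after each round, and a colored $u$ gets mark $\mathrm{det}$. Clean $u$: the palette is recomputed in each round and consists of $\max(\deg_H(u)+1,\lfloor 3^{i-5}/2\rfloor+1)$ colors that are blank or unique for $u$; a colored $u$ gets mark $(k,i)$, and if its color was unique, the lower neighbor that had this color becomes uncolored. Which colors of the admissible set make up a palette may depend in any way on the execution so far. *Moving.* Let $\mathrm{Mrkd}_U$ and $\mathrm{Mrkd}_L$ be the sets of vertices uncolored in this batch that violate the upper condition, respectively only the lower condition. For $i=\lambda,\dots,5$, let the candidates be the vertices of $\mathrm{Mrkd}_U$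 at level $i$, and for $k=\lambda,\dots,i+1$ repeat the following until no candidate is left: set aside for the next $k$ the candidates that violate $|N_u(1,k-1)|\ge 3^{k-1}$ or $|N_u(1,k)|\le 3^k$, sample each remaining candidate independently with probability $1/24$, and move to level $k$ those sampled vertices that have at most $3^{k-1}/4$ sampled neighbors. Then, for $i=5,\dots,\lambda$, sample each vertex of $\mathrm{Mrkd}_L$ at level $i$ independently with probability $1/(2\cdot 3^6)$, and move to level $\max(5,i-4)$ those sampled vertices that have at most $3^{i-5}$ sampled neighbors. *Records and cost.* The record of $u$ is the sequence $\tau_u^0,\tau_u^1,\dots$ of times at which $u$ was colored, where $\tau_u^0$ is the (clean) initial coloring. A recoloring $\tau_u^i$ at level $\ell_i(u)$ has base level $b_i(u)=\max(\lfloor\log_3|N_u(1,\ell_i(u))|\rfloor,\ell_i(u))$ and cost $w(\tau_u^i)=3^{\max(b_i(u),\ell_{i+1}(u))}$, where $\ell_{i+1}(u)$ is the level of $u$ after the moving phase of that batch. Let $C_T$ be the set of recolorings of clean spawning vertices, i.e. of vertices that are clean when recolored and that were uncolored in the initialization of the batch (because of an inserted monochromatic edge). Let $CC_T$ be the set of those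 $\tau_u^i\in C_T$ whose predecessor $\tau_u^{i-1}$ was the coloring of a clean vertex, and let $w(CC_T)=\sum_{\tau\in CC_T}w(\tau)$. Then $\mathbf E[w(CC_T)]=O(T)$: there is an absolute constant $C$ such that $\mathbf E[w(CC_T)]\le C\,T$ for all $V$, all $\Delta$, all such sequences of batches, and all ways to choose the palettes. -/

import Mathlib

open scoped ENNReal

noncomputable section

namespace DynColoring

/-! ## Probabilistic programs -/

/-- Expected value of a natural-number valued quantity under a discrete probability law. -/
def expect {α : Type*} (p : PMF α) (f : α → ℕ) : ℝ≥0∞ := ∑' a, p a * (f a : ℝ≥0∞)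

/-- The law of the state of `while cond do body` after at most `n` passes. -/
def whileSteps {α : Type*} (cond : α → Prop) [DecidablePred cond] (body : α → PMF α) :
    ℕ → α → PMF α
  | 0, s => PMF.pure s
  | n + 1, s => if cond s then (body s).bind (whileSteps cond body n) else PMF.pure s

/-- The mass that the loop `while cond do body`, started in `s`, puts on halting in state `t`
(the supremum is that of a sequence that is nondecreasing in the number of passes). -/
def whileMass {α : Type*} (cond : α → Prop) [DecidablePred cond] (body : α → PMF α)
    (s t : α) : ℝ≥0∞ :=
  if cond t then 0 else ⨆ n, whileSteps cond body n s t

open Classical in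
/-- The law of the final state of `while cond do body`, started in `s`. It is meaningful for loops
that halt almost surely; for others the value is the conventional `pure s`. -/
def whileLoop {α : Type*} (cond : α → Prop) [DecidablePred cond] (body : α → PMF α)
    (s : α) : PMF α :=
  if h : HasSum (whileMass cond body s) 1 then ⟨whileMass cond body s, h⟩ else PMF.pure s

/-- `for i in l do body i`. -/
def forEach {α : Type*} (body : ℕ → α → PMF α) : List ℕ → α → PMF α
  | [], s => PMF.pure s
  | i :: l, s => (body i s).bind (forEach body l)

/-! ## Batches of edge updates -/

/-- A batch of edge insertions and edge deletions. -/
structure Batch (V : Type*) where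
  ins : Finset (Sym2 V)
  del : Finset (Sym2 V)

/-- The number of edge updates in a batch. -/
def Batch.size {V : Type*} (S : Batch V) : ℕ := S.ins.card + S.del.card

/-- The graph after applying a batch. -/
def applyEdges {V : Type*} (G : SimpleGraph V) (S : Batch V) : SimpleGraph V :=
  SimpleGraph.fromEdgeSet ((G.edgeSet \ (S.del : Set (Sym2 V))) ∪ (S.ins : Set (Sym2 V)))

/-- `ValidFrom Δ G l`: starting from `G`, every batch of `l` inserts only absent (non-loop) edges,
deletes only present edges, and leaves a graph of maximum degree at most `Δ`. -/
def ValidFrom {V : Type*} (Δ : ℕ) : SimpleGraph V → List (Batch V) → Prop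
  | _, [] => True
  | G, S :: l =>
      (∀ e ∈ S.ins, ¬ e.IsDiag ∧ e ∉ G.edgeSet) ∧
      (∀ e ∈ S.del, e ∈ G.edgeSet) ∧
      (∀ v, ((applyEdges G S).neighborSet v).ncard ≤ Δ) ∧
      ValidFrom Δ (applyEdges G S) l

/-- The total number of edge updates in a sequence of batches. -/
def totalUpdates {V : Type*} (l : List (Batch V)) : ℕ := (l.map Batch.size).sum

/-! ## The state of the algorithm -/

/-- The recoloring mark stored at a vertex: `det` if it was last recolored as a dirty vertex,
otherwise the number of the batch and the level at which it was last colored at random. -/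
inductive Mark where
  | det : Mark
  | rand (batch level : ℕ) : Mark

/-- `a.AtLeastAsRecent b`. The mark `det` beats every random mark. Among random marks a later batch
is more recent; inside a batch the levels are colored from top to bottom, so a lower level is more
recent. -/
def Mark.AtLeastAsRecent : Mark → Mark → Prop
  | .det, _ => True
  | .rand _ _, .det => False
  | .rand k i, .rand k' i' => k' < k ∨ (k = k' ∧ i ≤ i')

/-- An entry of the record of a vertex, written each time the vertex is colored. -/
structure Timestamp where
  /-- number of the batch (`0` for the initial coloring) -/
  batch : ℕ
  /-- level of the vertex when it is recolored -/
  level : ℕ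
  /-- base level of the vertex when it is recolored -/
  base : ℕ
  /-- level of the vertex after the moving phase of that batch -/
  newLevel : ℕ
  /-- the vertex was clean when recolored -/
  clean : Prop
  /-- the vertex spawned its chain: it was uncolored because of an inserted monochromatic edge,
  and not because a vertex above it took its color -/
  spawn : Prop

/-- The cost `3 ^ max(base level, level after moving)` of a timestamp. -/
def Timestamp.cost (τ : Timestamp) : ℕ := 3 ^ max τ.base τ.newLevel

/-- The important clean timestamps: those of clean spawning vertices. -/
def Timestamp.InC (τ : Timestamp) : Prop := τ.clean ∧ τ.spawn

/-- A snapshot of graph, levels and colors. -/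
structure Snapshot (V : Type*) (Δ : ℕ) where
  graph : SimpleGraph V
  level : V → ℕ
  color : V → Option (Fin (Δ + 1))

/-- The state of the algorithm. -/
structure Config (V : Type*) (Δ : ℕ) where
  /-- the current graph -/
  graph : SimpleGraph V
  /-- the hierarchical partition -/
  level : V → ℕ
  /-- the current coloring; `none` marks an uncolored vertex -/
  color : V → Option (Fin (Δ + 1))
  mark : V → Mark
  /-- number of the current batch -/
  batch : ℕ
  /-- vertices uncolored in this batch because of an inserted monochromatic edge -/
  spawned : Finset V
  /-- all vertices uncolored in this batch so far -/
  blanked : Finset V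
  /-- palettes of the current list-coloring instance -/
  palette : V → Finset (Fin (Δ + 1))
  /-- vertices still to be considered for the current target level of the raising procedure -/
  cand : Finset V
  /-- vertices set aside for the next target level of the raising procedure -/
  rest : Finset V
  /-- the record of each vertex, most recent timestamp first -/
  record : V → List Timestamp
  /-- all earlier stages of the execution, most recent first -/
  past : List (Snapshot V Δ)

open Classical in
/-- The choices allowed to each vertex in a round of partial list-coloring on the vertex set `H`:
a vertex of `H` proposes a color of its palette, the other vertices propose nothing. -/
def proposalSet {V : Type*} {Δ : ℕ} (H : Finset V) (P : V → Finset (Fin (Δ + 1))) (v : V) :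
    Finset (Option (Fin (Δ + 1))) :=
  if v ∈ H ∧ (P v).Nonempty then (P v).map Function.Embedding.some else {none}

theorem proposalSet_nonempty {V : Type*} {Δ : ℕ} (H : Finset V) (P : V → Finset (Fin (Δ + 1))) (v : V) :
    (proposalSet H P v).Nonempty := by
  unfold proposalSet
  split_ifs with h
  · simpa using h.2
  · simp

variable {V : Type*} [Fintype V] {Δ : ℕ}

/-- Number of levels: levels range over `5, …, numLevels Δ`. -/
def numLevels (Δ : ℕ) : ℕ := max 5 (Nat.clog 3 Δ)

namespace Config

/-- Append the present stage to the history. -/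
def save (s : Config V Δ) : Config V Δ :=
  { s with past := ⟨s.graph, s.level, s.color⟩ :: s.past }

open Classical in
/-- Neighbors of `u` at levels at most `k`. -/
def nbrsUpTo (s : Config V Δ) (u : V) (k : ℕ) : Finset V :=
  {v | s.graph.Adj u v ∧ s.level v ≤ k}

open Classical in
/-- Neighbors of `u` inside `H`. -/
def nbrsIn (s : Config V Δ) (H : Finset V) (u : V) : Finset V :=
  {v ∈ H | s.graph.Adj u v}

/-- The upper condition. -/
def Upper (s : Config V Δ) (u : V) : Prop :=
  (s.nbrsUpTo u (s.level u)).card ≤ 3 ^ (s.level u + 2)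

/-- The lower condition (it asks nothing at the bottom level `5`). -/
def Lower (s : Config V Δ) (u : V) : Prop :=
  5 < s.level u → 3 ^ (s.level u - 5) ≤ (s.nbrsUpTo u (s.level u - 1)).card

/-- A vertex is clean if it satisfies both conditions; otherwise it is dirty. -/
def Clean (s : Config V Δ) (u : V) : Prop := s.Upper u ∧ s.Lower u

/-- The base level `max(⌊log₃ |N_u(1, ℓ(u))|⌋, ℓ(u))`. -/
def baseLevel (s : Config V Δ) (u : V) : ℕ :=
  max (Nat.log 3 (s.nbrsUpTo u (s.level u)).card) (s.level u)

open Classical in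
/-- The blank colors of `u`: colors that no neighbor has. -/
def blankColors (s : Config V Δ) (u : V) : Finset (Fin (Δ + 1)) :=
  {c | ∀ v, s.graph.Adj u v → s.color v ≠ some c}

open Classical in
/-- The unique colors of `u`: colors that no neighbor at the level of `u` or above has, and that
exactly one neighbor at a lower level has. -/
def uniqueColors (s : Config V Δ) (u : V) : Finset (Fin (Δ + 1)) :=
  {c | (∀ v, s.graph.Adj u v → s.level u ≤ s.level v → s.color v ≠ some c) ∧
    ∃! v, s.graph.Adj u v ∧ s.level v < s.level u ∧ s.color v = some c}

open Classical in
/-- The uncolored dirty vertices at level `i`. -/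
def marked (s : Config V Δ) (i : ℕ) : Finset V :=
  {u | s.color u = none ∧ s.level u = i ∧ ¬ s.Clean u}

open Classical in
/-- The uncolored clean vertices at level `i`. -/
def unmarked (s : Config V Δ) (i : ℕ) : Finset V :=
  {u | s.color u = none ∧ s.level u = i ∧ s.Clean u}

end Config

/-- How the implementation picks "the first `m`" colors out of a set of colors that its arrays hold
in some order. The order in the arrays may depend on the whole execution so far. -/
structure PaletteRule (V : Type*) (Δ : ℕ) where
  pick : Config V Δ → V → Finset (Fin (Δ + 1)) → ℕ → Finset (Fin (Δ + 1))
  pick_subset : ∀ s u A m, pick s u A m ⊆ A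
  card_pick : ∀ s u A m, m ≤ A.card → (pick s u A m).card = m

/-! ## Initialization phase -/

open Classical in
/-- Apply batch number `k`. For each inserted monochromatic edge, uncolor the endpoint that was
recolored most recently (both endpoints in case of a tie). -/
def initPhase (k : ℕ) (S : Batch V) (s : Config V Δ) : Config V Δ :=
  let B : Finset V := {u | ∃ v, s(u, v) ∈ S.ins ∧ s.color u = s.color v ∧
    (s.mark u).AtLeastAsRecent (s.mark v)}
  { s.save with
    graph := applyEdges s.graph S
    color := fun u => if u ∈ B then none else s.color u
    batch := k
    spawned := B
    blanked := B }

/-! ## Coloring phase -/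

open Classical in
/-- Independent proposals, each uniform in the palette of its vertex: the uniform law on the
product of the palettes. -/
def propose (H : Finset V) (P : V → Finset (Fin (Δ + 1))) :
    PMF (V → Option (Fin (Δ + 1))) :=
  PMF.uniformOfFinset (Fintype.piFinset (proposalSet H P))
    (Fintype.piFinset_nonempty.2 (proposalSet_nonempty H P))

open Classical in
/-- The vertices of `H` that keep their proposal `f`: no neighbor in `H` proposed the same color. -/
def accepted (s : Config V Δ) (H : Finset V) (f : V → Option (Fin (Δ + 1))) : Finset V :=
  {u ∈ H | f u ≠ none ∧ ∀ v ∈ H, s.graph.Adj u v → f v ≠ f u}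

open Classical in
/-- The palettes with which the marked vertices at level `i` start: `deg_H(u) + 1` blank colors. -/
def startMarked (R : PaletteRule V Δ) (i : ℕ) (s : Config V Δ) : Config V Δ :=
  { s.save with
    palette := fun u =>
      if u ∈ s.marked i then R.pick s u (s.blankColors u) ((s.nbrsIn (s.marked i) u).card + 1)
      else ∅ }

open Classical in
/-- The effect of a round on the marked vertices at level `i` with proposals `f`. -/
def commitMarked (i : ℕ) (s : Config V Δ) (f : V → Option (Fin (Δ + 1))) : Config V Δ :=
  let L := accepted s (s.marked i) f
  { s.save with
    color := fun u => if u ∈ L then f u else s.color u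
    mark := fun u => if u ∈ L then Mark.det else s.mark u
    palette := fun u => {c ∈ s.palette u | ∀ v ∈ L, s.graph.Adj u v → f v ≠ some c} }

open Classical in
/-- Color all marked vertices at level `i` with blank colors. -/
def colorMarked (R : PaletteRule V Δ) (i : ℕ) (s : Config V Δ) : PMF (Config V Δ) :=
  whileLoop (fun t => (t.marked i).Nonempty)
    (fun t => (propose (t.marked i) t.palette).map (commitMarked i t))
    (startMarked R i s)

/-- The palette of an unmarked vertex `u` at level `i`, recomputed in each round:
`max(deg_H(u) + 1, ⌊3^(i-5)/2⌋ + 1)` blank or unique colors. -/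
def unmarkedPalette (R : PaletteRule V Δ) (i : ℕ) (s : Config V Δ) (u : V) :
    Finset (Fin (Δ + 1)) :=
  R.pick s u (s.blankColors u ∪ s.uniqueColors u)
    (max ((s.nbrsIn (s.unmarked i) u).card + 1) (3 ^ (i - 5) / 2 + 1))

open Classical in
/-- The effect of a round on the unmarked vertices at level `i` with proposals `f`. A lower neighbor
whose color was taken becomes uncolored. -/
def commitUnmarked (i : ℕ) (s : Config V Δ) (f : V → Option (Fin (Δ + 1))) : Config V Δ :=
  let L := accepted s (s.unmarked i) f
  let A : Finset V := {v | ∃ u ∈ L, s.graph.Adj u v ∧ s.level v < s.level u ∧ s.color v = f u}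
  { s.save with
    color := fun u => if u ∈ L then f u else if u ∈ A then none else s.color u
    mark := fun u => if u ∈ L then Mark.rand s.batch i else s.mark u
    blanked := s.blanked ∪ A }

open Classical in
/-- Color all unmarked vertices at level `i` with blank or unique colors. -/
def colorUnmarked (R : PaletteRule V Δ) (i : ℕ) (s : Config V Δ) : PMF (Config V Δ) :=
  whileLoop (fun t => (t.unmarked i).Nonempty)
    (fun t => (propose (t.unmarked i) (unmarkedPalette R i t)).map (commitUnmarked i t))
    s

/-- The levels `5, …, numLevels Δ` from bottom to top. -/
def levelsUp (Δ : ℕ) : List ℕ := List.range' 5 (numLevels Δ - 4)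

/-- The levels from top to bottom. -/
def levelsDown (Δ : ℕ) : List ℕ := (levelsUp Δ).reverse

/-- The coloring phase: top-down, first marked and then unmarked vertices of each level. -/
def colorPhase (R : PaletteRule V Δ) (s : Config V Δ) : PMF (Config V Δ) :=
  forEach (fun i t => (colorMarked R i t).bind (colorUnmarked R i)) (levelsDown Δ) s

/-! ## Moving phase -/

open Classical in
/-- A random subset of `U` that contains each vertex independently with probability `1 / m`. -/
def sampleSubset (m : ℕ) [NeZero m] (U : Finset V) : PMF (Finset V) :=
  (PMF.uniformOfFintype (V → Fin m)).map fun g => {u ∈ U | g u = 0}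

open Classical in
/-- The candidates that may be raised to level `k`. -/
def raisable (k : ℕ) (s : Config V Δ) : Finset V :=
  {u ∈ s.cand | 3 ^ (k - 1) ≤ (s.nbrsUpTo u (k - 1)).card ∧ (s.nbrsUpTo u k).card ≤ 3 ^ k}

open Classical in
/-- Raise to level `k` the vertices of the sample `S` with at most `3^(k-1)/4` neighbors in `S`. -/
def commitRaise (k : ℕ) (s : Config V Δ) (S : Finset V) : Config V Δ :=
  let M : Finset V := {u ∈ S | 4 * (s.nbrsIn S u).card ≤ 3 ^ (k - 1)}
  { s.save with
    level := fun u => if u ∈ M then k else s.level u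
    cand := raisable k s \ M
    rest := s.rest ∪ (s.cand \ raisable k s) }

/-- Process target level `k` until no candidate is left; those set aside are the candidates for the
next target level. -/
def raiseTo (k : ℕ) (s : Config V Δ) : PMF (Config V Δ) :=
  (whileLoop (fun t => t.cand.Nonempty)
    (fun t => (sampleSubset 24 (raisable k t)).map (commitRaise k t)) s).map
    fun t => { t.save with cand := t.rest, rest := ∅ }

open Classical in
/-- Raise the vertices of `U` that are at level `i`. The target levels run from the top level down
to `i + 1`. -/
def raise (U : Finset V) (i : ℕ) (s : Config V Δ) : PMF (Config V Δ) :=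
  forEach raiseTo (List.range' (i + 1) (numLevels Δ - i)).reverse
    { s.save with cand := {u ∈ U | s.level u = i}, rest := ∅ }

open Classical in
/-- Lower to level `max(5, i - 4)` the vertices of the sample `S` with at most `3^(i-5)` neighbors
in `S`. -/
def commitLower (i : ℕ) (s : Config V Δ) (S : Finset V) : Config V Δ :=
  { s.save with
    level := fun u =>
      if u ∈ S ∧ (s.nbrsIn S u).card ≤ 3 ^ (i - 5) then max 5 (i - 4) else s.level u }

open Classical in
/-- Lower the vertices of `U` that are at level `i`; each is sampled with probability
`1 / (2 * 3 ^ 6)`. -/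
def lower (U : Finset V) (i : ℕ) (s : Config V Δ) : PMF (Config V Δ) :=
  (sampleSubset (2 * 3 ^ 6) {u ∈ U | s.level u = i}).map (commitLower i s)

open Classical in
/-- The moving phase: raise, top-down, the vertices uncolored in this batch that violate the upper
condition; then lower, bottom-up, those that violate only the lower condition. Both sets are fixed
by the state `s` at the end of the coloring phase. -/
def movePhase (s : Config V Δ) : PMF (Config V Δ) :=
  let U : Finset V := {u ∈ s.blanked | ¬ s.Upper u}
  let L : Finset V := {u ∈ s.blanked | s.Upper u ∧ ¬ s.Lower u}
  (forEach (raise U) (levelsDown Δ) s).bind (forEach (lower L) (levelsUp Δ))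

/-! ## The complete algorithm -/

open Classical in
/-- Extend the records by the recolorings of a batch: `s` is the state after the coloring phase and
`t` the state after the moving phase. (A vertex is recolored at most once per batch, and neither the
graph nor the levels change in the coloring phase.) -/
def writeRecord (s t : Config V Δ) : Config V Δ :=
  { t with
    record := fun u =>
      if u ∈ s.blanked then
        { batch := s.batch
          level := s.level u
          base := s.baseLevel u
          newLevel := t.level u
          clean := s.Clean u
          spawn := u ∈ s.spawned } :: t.record u
      else t.record u }

/-- Process batch number `k`. -/
def update (R : PaletteRule V Δ) (k : ℕ) (S : Batch V) (s : Config V Δ) : PMF (Config V Δ) :=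
  (colorPhase R (initPhase k S s)).bind fun t => (movePhase t).map (writeRecord t)

/-- The state before the first batch, with initial coloring `χ`: no edges, all vertices at level
`5`. The record of each vertex starts with its initial random coloring, a clean one. -/
def startConfig (χ : V → Fin (Δ + 1)) : Config V Δ where
  graph := ⊥
  level := fun _ => 5
  color := fun u => some (χ u)
  mark := fun _ => Mark.rand 0 5
  batch := 0
  spawned := ∅
  blanked := ∅
  palette := fun _ => ∅
  cand := ∅
  rest := ∅
  record := fun _ => [{ batch := 0, level := 5, base := 5, newLevel := 5,
                        clean := True, spawn := False }]
  past := []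

/-- Process a list of batches, the first of which has number `k`. -/
def runFrom (R : PaletteRule V Δ) : ℕ → List (Batch V) → Config V Δ → PMF (Config V Δ)
  | _, [], s => PMF.pure s
  | k, S :: l, s => (update R k S s).bind (runFrom R (k + 1) l)

open Classical in
/-- The law of the final state when the batches are processed from the empty graph with independent
uniform initial colors. -/
def run (R : PaletteRule V Δ) (l : List (Batch V)) : PMF (Config V Δ) :=
  (PMF.uniformOfFintype (V → Fin (Δ + 1))).bind fun χ => runFrom R 1 l (startConfig χ)

/-! ## The cost of clean recolorings with clean predecessor -/

open Classical in
/-- The cost in a single record (most recent timestamp first) of the important clean timestamps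
whose predecessor in the record is clean. -/
def ccCostList : List Timestamp → ℕ
  | τ :: τ' :: l => (if τ.InC ∧ τ'.clean then τ.cost else 0) + ccCostList (τ' :: l)
  | _ => 0

/-- The cost `w(CC_T)`. -/
def ccCost (s : Config V Δ) : ℕ := ∑ u, ccCostList (s.record u)

end DynColoring

end

open scoped ENNReal

set_option linter.unusedSectionVars false

noncomputable section

namespace DynColoring

/-! ## Expectations of discrete laws -/

section Expect

variable {α β : Type*}

/-! The proof is an amortized analysis. Let `I` be the number of edges inserted at `u` so far. A
level `i ≥ 6` is only reached with at least `3^(i-1)` neighbors, and every neighbor came with an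
insertion, so `3^i ≤ 3 * I` always (`LevelInv.pow_le`). Hence a budget of `81 * I` at `u` can lend
`27 * 3^i` when `u` is clean and gets a random color at level `i`. A third pays the cost of `u`
itself, at most `3^(i+2)` by the upper condition. A third repays the loan of the vertex that `u`
uncolors, which sits at a level at most `i - 1`. The last third covers the event that the loan is
never granted because `u` is at risk (`UnmarkedStep.phasePot_add_le`).

A loan must be repaid when an inserted monochromatic edge uncolors `u`. If more than `3^i / 11664`
edges have been inserted at `u` since its coloring, the extra charge `314928 = 27 * 11664` per
insertion repays it. Otherwise the other endpoint is one of the at most `3^i / 11664` partners of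
`u`, a set fixed in advance because the updates are oblivious. As the most recently colored endpoint
is uncolored, that partner had the common color no later than `u`, so `u` was at risk and has no
loan (`vertexPot_initPhase_le`). Vertices colored afterwards carry more recent marks and never
create a risk (`credit_le_credit`).

It remains to bound the probability of a risk by `1/3` (`expect_collisions_le`). The palette of `u`
has at least `m = ⌊3^(i-5)/2⌋ + 1` colors (`le_card_blank_union_unique`) and a proposal is kept with
probability at least `1/4` (`card_piFinset_le_four_mul`). A supermartingale for a pair of vertices
(`expect_pairPot_le`) then shows that `u` ends with the color of a given partner with probability at
most `8 / m`. Summed over the partners this is at most `8 * 486 / 11664 = 1/3`.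

Altogether each insertion raises the potential by at most `317196` at each of its two ends, the
coloring phase does not raise it in expectation, and neither the moves nor the writing of records
raise it. -/

theorem expect_pure (a : α) (f : α → ℕ) : expect (PMF.pure a) f = f a := by
  classical
  unfold expect
  rw [tsum_eq_single a]
  · simp
  · intro b hb
    simp [PMF.pure_apply, hb]

theorem expect_bind (p : PMF α) (q : α → PMF β) (f : β → ℕ) :
    expect (p.bind q) f = ∑' a, p a * expect (q a) f := by
  unfold expect
  simp only [PMF.bind_apply, ← ENNReal.tsum_mul_right, ← ENNReal.tsum_mul_left]
  rw [ENNReal.tsum_comm]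
  simp only [mul_assoc]

theorem expect_map (p : PMF α) (g : α → β) (f : β → ℕ) :
    expect (p.map g) f = expect p (fun a => f (g a)) := by
  rw [← PMF.bind_pure_comp, expect_bind]
  simp [expect]

theorem expect_mono {p : PMF α} {f g : α → ℕ} (h : ∀ a ∈ p.support, f a ≤ g a) :
    expect p f ≤ expect p g := by
  refine ENNReal.tsum_le_tsum fun a => ?_
  by_cases ha : a ∈ p.support
  · gcongr
    exact h a ha
  · simp [(PMF.apply_eq_zero_iff p a).2 ha]

theorem expect_const (p : PMF α) (n : ℕ) : expect p (fun _ => n) = n := by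
  unfold expect
  rw [ENNReal.tsum_mul_right, p.tsum_coe, one_mul]

theorem expect_add (p : PMF α) (f g : α → ℕ) :
    expect p (fun a => f a + g a) = expect p f + expect p g := by
  unfold expect
  rw [← ENNReal.tsum_add]
  simp [mul_add]

theorem expect_const_mul (p : PMF α) (n : ℕ) (f : α → ℕ) :
    expect p (fun a => n * f a) = n * expect p f := by
  unfold expect
  rw [← ENNReal.tsum_mul_left]
  refine tsum_congr fun a => ?_
  push_cast
  ring

theorem expect_sum {ι : Type*} (p : PMF α) (s : Finset ι) (f : ι → α → ℕ) :
    expect p (fun a => ∑ i ∈ s, f i a) = ∑ i ∈ s, expect p (f i) := by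
  classical
  induction s using Finset.induction_on with
  | empty => simp [expect]
  | insert i s hi ih => simp [Finset.sum_insert hi, expect_add, ih]

theorem expect_bind_le {p : PMF α} {q : α → PMF β} {f : α → ℕ} {g : β → ℕ} {c : ℝ≥0∞}
    (h : ∀ a ∈ p.support, expect (q a) g ≤ f a + c) :
    expect (p.bind q) g ≤ expect p f + c := by
  rw [expect_bind]
  calc ∑' a, p a * expect (q a) g ≤ ∑' a, (p a * (f a : ℝ≥0∞) + p a * c) := by
        refine ENNReal.tsum_le_tsum fun a => ?_
        by_cases ha : a ∈ p.support
        · rw [← mul_add]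
          gcongr
          exact h a ha
        · simp [(PMF.apply_eq_zero_iff p a).2 ha]
    _ = expect p f + c := by
        rw [ENNReal.tsum_add, ENNReal.tsum_mul_right, p.tsum_coe, one_mul]
        rfl

/-- Turns a bound on a uniform expectation into an inequality between natural numbers, so that all
probabilities below become counts. -/
theorem expect_uniformOfFinset_le {s : Finset α} (hs : s.Nonempty) (f : α → ℕ) (a b : ℕ)
    (hb : 0 < b) (h : b * ∑ x ∈ s, f x ≤ a * s.card) :
    expect (PMF.uniformOfFinset s hs) f ≤ a / b := by
  classical
  have hc : (s.card : ℝ≥0∞) ≠ 0 := by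
    simpa using hs.ne_empty
  have hE : expect (PMF.uniformOfFinset s hs) f = (s.card : ℝ≥0∞)⁻¹ * ((∑ x ∈ s, f x : ℕ) : ℝ≥0∞) := by
    unfold expect
    rw [tsum_eq_sum (s := s)]
    · push_cast
      rw [Finset.mul_sum]
      refine Finset.sum_congr rfl fun x hx => ?_
      rw [PMF.uniformOfFinset_apply_of_mem hs hx]
    · intro x hx
      rw [PMF.uniformOfFinset_apply_of_notMem hs hx, zero_mul]
  rw [hE, ENNReal.le_div_iff_mul_le (Or.inl (by exact_mod_cast hb.ne')) (Or.inl (by simp)),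
    mul_assoc, ENNReal.inv_mul_le_iff hc (by simp)]
  have : ((b * ∑ x ∈ s, f x : ℕ) : ℝ≥0∞) ≤ ((a * s.card : ℕ) : ℝ≥0∞) := by exact_mod_cast h
  push_cast at this ⊢
  calc _ = (b : ℝ≥0∞) * ∑ x ∈ s, (f x : ℝ≥0∞) := by ring
    _ ≤ _ := this
    _ = _ := by ring

end Expect

/-! ## Loops -/

section Loops

variable {α : Type*} {cond : α → Prop} [DecidablePred cond] {body : α → PMF α} {Inv : α → Prop}

theorem whileSteps_support (hInv : ∀ t, Inv t → cond t → ∀ t' ∈ (body t).support, Inv t') (n : ℕ)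
    {s : α} (hs : Inv s) : ∀ t ∈ (whileSteps cond body n s).support, Inv t := by
  induction n generalizing s with
  | zero => simpa [whileSteps] using hs
  | succ n ih =>
    intro t ht
    rw [whileSteps] at ht
    split_ifs at ht with hc
    · obtain ⟨a, ha, hat⟩ := (PMF.mem_support_bind_iff _ _ _).1 ht
      exact ih (hInv s hs hc a ha) t hat
    · rw [PMF.mem_support_pure_iff] at ht
      exact ht ▸ hs

theorem expect_whileSteps_le (hInv : ∀ t, Inv t → cond t → ∀ t' ∈ (body t).support, Inv t')
    {f : α → ℕ} (hf : ∀ t, Inv t → cond t → expect (body t) f ≤ f t) (n : ℕ) {s : α} (hs : Inv s) :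
    expect (whileSteps cond body n s) f ≤ f s := by
  induction n generalizing s with
  | zero => simp [whileSteps, expect_pure]
  | succ n ih =>
    rw [whileSteps]
    split_ifs with hc
    · refine (expect_bind_le (f := f) (c := 0) fun a ha => ?_).trans ?_
      · simpa using ih (hInv s hs hc a ha)
      · simpa using hf s hs hc
    · rw [expect_pure]

/-- A halted state is absorbing, so its mass can only grow with further passes; for a state that
still satisfies `cond` this would fail. -/
theorem whileSteps_mono {s t : α} (ht : ¬ cond t) :
    Monotone fun n => whileSteps cond body n s t := by
  classical
  refine monotone_nat_of_le_succ fun n => ?_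
  induction n generalizing s with
  | zero =>
    rw [whileSteps, whileSteps]
    split_ifs with hc
    · rw [PMF.pure_apply, if_neg (by rintro rfl; exact ht hc)]
      exact zero_le
    · exact le_rfl
  | succ n ih =>
    rw [whileSteps, whileSteps]
    split_ifs with hc
    · rw [PMF.bind_apply, PMF.bind_apply]
      refine ENNReal.tsum_le_tsum fun a => ?_
      gcongr
      exact ih
    · exact le_rfl

/-- Monotone convergence, with sums as suprema of finite sums. -/
theorem tsum_whileMass_mul (s : α) (g : α → ℝ≥0∞) :
    ∑' t, whileMass cond body s t * g t =
      ⨆ n, ∑' t, (if cond t then 0 else whileSteps cond body n s t) * g t := by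
  have h1 : ∀ t, whileMass cond body s t * g t =
      ⨆ n, (if cond t then 0 else whileSteps cond body n s t) * g t := by
    intro t
    unfold whileMass
    split_ifs with hc
    · simp
    · rw [ENNReal.iSup_mul]
  simp only [h1]
  simp only [ENNReal.tsum_eq_iSup_sum]
  rw [iSup_comm]
  refine iSup_congr fun S => ?_
  rw [ENNReal.finsetSum_iSup_of_monotone]
  intro t m n hmn
  dsimp only
  split_ifs with hc
  · simp
  · gcongr
    exact whileSteps_mono hc hmn

theorem whileLoop_apply {s : α} (h : HasSum (whileMass cond body s) 1) (t : α) :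
    whileLoop cond body s t = whileMass cond body s t := by
  have : whileLoop cond body s = ⟨whileMass cond body s, h⟩ := dif_pos h
  rw [this]
  rfl

theorem whileLoop_eq_pure {s : α} (h : ¬ HasSum (whileMass cond body s) 1) :
    whileLoop cond body s = PMF.pure s := dif_neg h

/-- Optional stopping for a nonnegative supermartingale `f`: the halted mass after `n` passes is
part of the law after `n` passes, where the expectation is at most `f s`. The fallback value `pure
s` satisfies the bound as well, so termination is not needed here. -/
theorem expect_whileLoop_le (hInv : ∀ t, Inv t → cond t → ∀ t' ∈ (body t).support, Inv t')
    {f : α → ℕ} (hf : ∀ t, Inv t → cond t → expect (body t) f ≤ f t) {s : α} (hs : Inv s) :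
    expect (whileLoop cond body s) f ≤ f s := by
  by_cases h : HasSum (whileMass cond body s) 1
  · unfold expect
    simp only [whileLoop_apply h]
    rw [tsum_whileMass_mul]
    refine iSup_le fun n => le_trans ?_ (expect_whileSteps_le hInv hf n hs)
    refine ENNReal.tsum_le_tsum fun t => ?_
    gcongr
    split_ifs <;> simp
  · rw [whileLoop_eq_pure h, expect_pure]

theorem whileLoop_support (hInv : ∀ t, Inv t → cond t → ∀ t' ∈ (body t).support, Inv t') {s : α}
    (hs : Inv s) : ∀ t ∈ (whileLoop cond body s).support, Inv t := by
  intro t ht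
  by_cases h : HasSum (whileMass cond body s) 1
  · have h1 : whileMass cond body s t ≠ 0 := by
      rw [← whileLoop_apply h]
      exact (PMF.mem_support_iff _ _).1 ht
    unfold whileMass at h1
    split_ifs at h1 with hc
    · exact absurd rfl h1
    · have : ∃ n, whileSteps cond body n s t ≠ 0 := by
        by_contra! hcon
        exact h1 (by simp [hcon])
      obtain ⟨n, hn⟩ := this
      exact whileSteps_support hInv n hs t ((PMF.mem_support_iff _ _).2 hn)
  · rw [whileLoop_eq_pure h, PMF.mem_support_pure_iff] at ht
    exact ht ▸ hs

/-! ### Almost sure termination of loops -/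

theorem whileSteps_cond_le (hInv : ∀ t, Inv t → cond t → ∀ t' ∈ (body t).support, Inv t')
    {f : α → ℕ} (hpos : ∀ t, Inv t → cond t → 1 ≤ f t) {q : ℝ≥0∞}
    (hf : ∀ t, Inv t → cond t → expect (body t) f ≤ q * f t) (n : ℕ) {s : α} (hs : Inv s) :
    ∑' t, (if cond t then whileSteps cond body n s t else 0) ≤ q ^ n * f s := by
  classical
  induction n generalizing s with
  | zero =>
    rw [tsum_eq_single s]
    · split_ifs with hc
      · simpa [whileSteps] using hpos s hs hc
      · simp
    · intro t ht
      simp [whileSteps, PMF.pure_apply, ht]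
  | succ n ih =>
    by_cases hc : cond s
    · have h1 : ∀ t, (if cond t then whileSteps cond body (n + 1) s t else 0) =
          ∑' a, body s a * (if cond t then whileSteps cond body n a t else 0) := by
        intro t
        rw [whileSteps, if_pos hc, PMF.bind_apply]
        split_ifs <;> simp
      simp only [h1]
      rw [ENNReal.tsum_comm]
      simp only [ENNReal.tsum_mul_left]
      calc _ ≤ ∑' a, body s a * (q ^ n * f a) := by
            refine ENNReal.tsum_le_tsum fun a => ?_
            by_cases ha : a ∈ (body s).support
            · gcongr
              exact ih (hInv s hs hc a ha)
            · simp [(PMF.apply_eq_zero_iff _ a).2 ha]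
        _ = q ^ n * expect (body s) f := by
            unfold expect
            rw [← ENNReal.tsum_mul_left]
            refine tsum_congr fun a => ?_
            ring
        _ ≤ q ^ n * (q * f s) := by
            gcongr
            exact hf s hs hc
        _ = _ := by ring
    · have : ∀ t, (if cond t then whileSteps cond body (n + 1) s t else 0) = 0 := by
        intro t
        rw [whileSteps, if_neg hc, PMF.pure_apply]
        split_ifs with h1 h2
        · exact absurd (h2 ▸ h1) hc
        · rfl
        · rfl
      simp [this]

theorem tsum_whileMass_eq_one
    (hInv : ∀ t, Inv t → cond t → ∀ t' ∈ (body t).support, Inv t')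
    {f : α → ℕ} (hpos : ∀ t, Inv t → cond t → 1 ≤ f t) {q : ℝ≥0∞} (hq : q < 1)
    (hf : ∀ t, Inv t → cond t → expect (body t) f ≤ q * f t) {s : α} (hs : Inv s) :
    ∑' t, whileMass cond body s t = 1 := by
  have key := tsum_whileMass_mul (cond := cond) (body := body) s (fun _ => 1)
  simp only [mul_one] at key
  have hsplit : ∀ n, ∑' t, (if cond t then 0 else whileSteps cond body n s t) +
      ∑' t, (if cond t then whileSteps cond body n s t else 0) = 1 := by
    intro n
    rw [← ENNReal.tsum_add, ← (whileSteps cond body n s).tsum_coe]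
    refine tsum_congr fun t => ?_
    split_ifs <;> simp
  refine le_antisymm ?_ ?_
  · rw [key]
    exact iSup_le fun n => (hsplit n) ▸ le_self_add
  · have hle : ∀ n : ℕ, 1 ≤ ∑' t, whileMass cond body s t + q ^ n * f s := by
      intro n
      rw [← hsplit n, key]
      refine add_le_add (le_iSup (fun n => ∑' t, (if cond t then 0 else whileSteps cond body n s t)) n)
        (whileSteps_cond_le hInv hpos hf n hs)
    have hlim : Filter.Tendsto (fun n : ℕ => ∑' t, whileMass cond body s t + q ^ n * f s)
        Filter.atTop (nhds (∑' t, whileMass cond body s t + 0 * f s)) := by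
      refine tendsto_const_nhds.add ?_
      exact ENNReal.Tendsto.mul_const (ENNReal.tendsto_pow_atTop_nhds_zero_of_lt_one hq)
        (Or.inr (by simp))
    simpa using ge_of_tendsto' hlim hle

/-- The fallback value `pure s` could still satisfy `cond`, so this needs actual termination. Since
`f ≥ 1` while the loop runs and `f` shrinks by the factor `q` per pass in expectation, the loop is
still running after `n` passes with probability at most `q ^ n * f s`. -/
theorem whileLoop_support_not_cond
    (hInv : ∀ t, Inv t → cond t → ∀ t' ∈ (body t).support, Inv t')
    {f : α → ℕ} (hpos : ∀ t, Inv t → cond t → 1 ≤ f t) {q : ℝ≥0∞} (hq : q < 1)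
    (hf : ∀ t, Inv t → cond t → expect (body t) f ≤ q * f t) {s : α} (hs : Inv s) :
    ∀ t ∈ (whileLoop cond body s).support, ¬ cond t := by
  intro t ht hc
  have h : HasSum (whileMass cond body s) 1 := by
    rw [← tsum_whileMass_eq_one hInv hpos hq hf hs]
    exact ENNReal.summable.hasSum
  have h1 : whileMass cond body s t ≠ 0 := by
    rw [← whileLoop_apply h]
    exact (PMF.mem_support_iff _ _).1 ht
  simp [whileMass, hc] at h1

theorem forEach_support {body : ℕ → α → PMF α} {l : List ℕ}
    (h : ∀ i ∈ l, ∀ s, Inv s → ∀ t ∈ (body i s).support, Inv t) {s : α} (hs : Inv s) :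
    ∀ t ∈ (forEach body l s).support, Inv t := by
  induction l generalizing s with
  | nil => simpa [forEach] using hs
  | cons i l ih =>
    intro t ht
    rw [forEach] at ht
    obtain ⟨a, ha, hat⟩ := (PMF.mem_support_bind_iff _ _ _).1 ht
    exact ih (fun j hj => h j (List.mem_cons_of_mem _ hj)) (h i List.mem_cons_self s hs a ha) t hat

end Loops

/-! ## Counting in finite products -/

section Counting

variable {ι κ : Type*} [Fintype ι] [DecidableEq ι] [DecidableEq κ]

/-- A uniform coordinate hits a value determined by the other coordinates with probability at most
`1 / |A u|`. Overwriting coordinate `u` by an arbitrary element of `A u` is injective on the bad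
tuples: the overwritten value is recovered as `c f`, because `c` ignores coordinate `u`. -/
theorem card_mul_card_filter_piFinset_le (A : ι → Finset κ) (u : ι) (c : (ι → κ) → κ)
    (hc : ∀ f x, c (Function.update f u x) = c f) :
    (A u).card * ((Fintype.piFinset A).filter fun f => f u = c f).card ≤
      (Fintype.piFinset A).card := by
  rw [← Finset.card_product]
  refine Finset.card_le_card_of_injOn (fun q => Function.update q.2 u q.1) ?_ ?_
  · rintro ⟨x, f⟩ h
    simp only [Finset.coe_product, Set.mem_prod, Finset.mem_coe, Finset.mem_filter,
      Fintype.mem_piFinset] at h ⊢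
    intro v
    by_cases hv : v = u
    · subst hv
      simpa using h.1
    · simpa [hv] using h.2.1 v
  · rintro ⟨x, f⟩ h ⟨y, g⟩ h' heq
    simp only [Finset.coe_product, Set.mem_prod, Finset.mem_coe, Finset.mem_filter] at h h' heq
    have hxy : x = y := by simpa using congrFun heq u
    have hfg : c f = c g := by rw [← hc f x, ← hc g y, heq]
    refine Prod.ext hxy (funext fun v => ?_)
    by_cases hv : v = u
    · subst hv
      simp only
      rw [h.2.2, h'.2.2, hfg]
    · simpa [hv] using congrFun heq v

/-- The convex function `4 ^ (-p)` lies below its chord over `[0, 1/2]`, which is `1 - p`. -/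
theorem one_sub_ge_exp {p : ℝ} (h0 : 0 ≤ p) (h1 : p ≤ 1 / 2) :
    Real.exp (-(Real.log 4 * p)) ≤ 1 - p := by
  have hconv := convexOn_exp.2 (Set.mem_univ (0 : ℝ)) (Set.mem_univ (-(Real.log 4 / 2)))
    (show (0 : ℝ) ≤ 1 - 2 * p by linarith) (show (0 : ℝ) ≤ 2 * p by linarith) (by ring)
  have hlog : Real.exp (-(Real.log 4 / 2)) = 1 / 2 := by
    have : Real.log 4 = 2 * Real.log 2 := by
      rw [show (4 : ℝ) = 2 ^ 2 by norm_num, Real.log_pow]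
      norm_num
    rw [this, show -(2 * Real.log 2 / 2) = -Real.log 2 by ring, Real.exp_neg,
      Real.exp_log (by norm_num)]
    norm_num
  simp only [smul_eq_mul, Real.exp_zero, hlog] at hconv
  rw [show -(Real.log 4 * p) = (1 - 2 * p) * 0 + 2 * p * -(Real.log 4 / 2) by ring]
  linarith

/-- With probability at least `1/4` nobody in `N` proposes the color of `u`. Given `f u = c` the
probability is `∏ (1 - p c v) ≥ 4 ^ (-x c)`, where `x c = ∑ p c v` is the expected number of
proposals of `c` in `N`. The average of `x c` over `A u` is at most `|N| / |A u| ≤ 1`, and convexity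
of `4 ^ (-x)` gives `1/4`. -/
theorem card_piFinset_le_four_mul (A : ι → Finset κ) (hA : ∀ v, (A v).Nonempty) (u : ι)
    (N : Finset ι) (hu : u ∉ N) (hN : N.card ≤ (A u).card) (h2 : ∀ v ∈ N, 2 ≤ (A v).card) :
    (Fintype.piFinset A).card ≤
      4 * ((Fintype.piFinset A).filter fun f => ∀ v ∈ N, f v ≠ f u).card := by
  set Ω := Fintype.piFinset A with hΩ
  -- `B c` is the box of the good tuples with `f u = c`, and `p c v` is the probability that `v`
  -- proposes `c`.
  let B : κ → ι → Finset κ := fun c v =>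
    if v = u then {c} else if v ∈ N then (A v).erase c else A v
  let p : κ → ι → ℝ := fun c v => if c ∈ A v then ((A v).card : ℝ)⁻¹ else 0
  have hApos : ∀ v, (0 : ℝ) < (A v).card := fun v => by exact_mod_cast (hA v).card_pos
  have hcount : (Ω.filter fun f => ∀ v ∈ N, f v ≠ f u).card =
      ∑ c ∈ A u, (Fintype.piFinset (B c)).card := by
    rw [Finset.card_eq_sum_card_fiberwise (f := fun f => f u) (t := A u)]
    · refine Finset.sum_congr rfl fun c hc => ?_
      congr 1
      ext f
      simp only [Finset.mem_filter, Fintype.mem_piFinset, hΩ, B]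
      constructor
      · rintro ⟨⟨hf, hne⟩, rfl⟩ v
        split_ifs with h1 h3
        · simp [h1]
        · exact Finset.mem_erase.2 ⟨hne v h3, hf v⟩
        · exact hf v
      · intro h
        have hfu : f u = c := by simpa using h u
        have hvne : ∀ v ∈ N, v ≠ u := fun v hv he => hu (he ▸ hv)
        refine ⟨⟨fun v => ?_, fun v hv => ?_⟩, hfu⟩
        · have hv := h v
          split_ifs at hv with h1 h3
          · subst h1
            exact hfu.symm ▸ hc
          · exact (Finset.mem_erase.1 hv).2
          · exact hv
        · have hv' := h v
          rw [if_neg (hvne v hv), if_pos hv] at hv'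
          exact hfu.symm ▸ (Finset.mem_erase.1 hv').1
    · intro f hf
      exact Fintype.mem_piFinset.1 (Finset.mem_filter.1 hf).1 u
  have hcard : ∀ c ∈ A u, ((Fintype.piFinset (B c)).card : ℝ) =
      Ω.card * ((A u).card : ℝ)⁻¹ * ∏ v ∈ N, (1 - p c v) := by
    intro c hc
    have h1 : ∀ v, ((B c v).card : ℝ) = (A v).card *
        ((if v = u then ((A u).card : ℝ)⁻¹ else 1) * (if v ∈ N then 1 - p c v else 1)) := by
      intro v
      have hne := (hApos v).ne'
      simp only [B, p]
      by_cases h1 : v = u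
      · subst h1
        simp [hu, hne]
      by_cases h3 : v ∈ N
      · by_cases h4 : c ∈ A v
        · simp only [h1, h3, h4, if_true, if_false]
          rw [Finset.card_erase_of_mem h4, Nat.cast_sub (hA v).card_pos]
          field_simp
          simp
        · simp [h1, h3, h4]
      · simp [h1, h3]
    rw [Fintype.card_piFinset, Nat.cast_prod, Finset.prod_congr rfl fun v _ => h1 v,
      Finset.prod_mul_distrib, Finset.prod_mul_distrib, hΩ, Fintype.card_piFinset, Nat.cast_prod]
    simp [Finset.prod_ite_mem, Finset.prod_ite_eq', mul_assoc]
  have hp0 : ∀ c v, 0 ≤ p c v := by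
    intro c v
    simp only [p]
    split_ifs
    · exact (inv_pos.2 (hApos v)).le
    · exact le_rfl
  have hp1 : ∀ c, ∀ v ∈ N, p c v ≤ 1 / 2 := by
    intro c v hv
    simp only [p]
    split_ifs
    · rw [one_div]
      exact inv_anti₀ (by norm_num) (by exact_mod_cast h2 v hv)
    · norm_num
  -- The left side is the tangent of `4 ^ (-x)` at `x = 1`; being affine in `x`, it can be averaged
  -- over `c`.
  have hprod : ∀ c, (1 / 4) * (1 + Real.log 4 * (1 - ∑ v ∈ N, p c v)) ≤ ∏ v ∈ N, (1 - p c v) := by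
    intro c
    calc (1 / 4) * (1 + Real.log 4 * (1 - ∑ v ∈ N, p c v))
        ≤ (1 / 4) * Real.exp (Real.log 4 * (1 - ∑ v ∈ N, p c v)) := by
          have := Real.add_one_le_exp (Real.log 4 * (1 - ∑ v ∈ N, p c v))
          linarith
      _ = Real.exp (∑ v ∈ N, -(Real.log 4 * p c v)) := by
          rw [show (1 / 4 : ℝ) = Real.exp (-Real.log 4) by
            rw [Real.exp_neg, Real.exp_log (by norm_num)]
            norm_num, ← Real.exp_add, Finset.sum_neg_distrib, ← Finset.mul_sum]
          congr 1
          ring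
      _ = ∏ v ∈ N, Real.exp (-(Real.log 4 * p c v)) := Real.exp_sum _ _
      _ ≤ _ := Finset.prod_le_prod (fun v _ => (Real.exp_pos _).le)
          fun v hv => one_sub_ge_exp (hp0 c v) (hp1 c v hv)
  have hsum : ∑ c ∈ A u, ∑ v ∈ N, p c v ≤ (A u).card := by
    rw [Finset.sum_comm]
    calc _ ≤ ∑ v ∈ N, (1 : ℝ) := by
          refine Finset.sum_le_sum fun v hv => ?_
          simp only [p]
          rw [← Finset.sum_filter, Finset.sum_const, nsmul_eq_mul]
          rw [← div_eq_mul_inv, div_le_one (hApos v)]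
          exact_mod_cast Finset.card_le_card fun c hc => (Finset.mem_filter.1 hc).2
      _ ≤ _ := by simpa using (by exact_mod_cast hN : (N.card : ℝ) ≤ (A u).card)
  have hlog : 0 ≤ Real.log 4 := Real.log_nonneg (by norm_num)
  have hfin : (Ω.card : ℝ) ≤ 4 * ((Ω.filter fun f => ∀ v ∈ N, f v ≠ f u).card : ℝ) := by
    rw [hcount, Nat.cast_sum, Finset.sum_congr rfl hcard, ← Finset.mul_sum]
    have h3 : (1 / 4) * ((A u).card : ℝ) ≤ ∑ c ∈ A u, ∏ v ∈ N, (1 - p c v) := by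
      calc _ ≤ ∑ c ∈ A u, (1 / 4) * (1 + Real.log 4 * (1 - ∑ v ∈ N, p c v)) := by
            rw [← Finset.mul_sum, Finset.sum_add_distrib, ← Finset.mul_sum,
              Finset.sum_sub_distrib]
            simp only [Finset.sum_const, nsmul_eq_mul, mul_one]
            have := mul_nonneg hlog (sub_nonneg.2 hsum)
            linarith
        _ ≤ _ := Finset.sum_le_sum fun c _ => hprod c
    have h4 : (0 : ℝ) ≤ Ω.card * ((A u).card : ℝ)⁻¹ := by positivity
    have h5 := mul_le_mul_of_nonneg_left h3 h4
    have h6 : (Ω.card : ℝ) * ((A u).card : ℝ)⁻¹ * (1 / 4 * (A u).card) = Ω.card / 4 := by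
      have := (hApos u).ne'
      field_simp
    linarith
  exact_mod_cast hfin

end Counting

variable {V : Type*} [Fintype V] {Δ : ℕ}

/-! ## Insertions at a vertex -/

open Classical in
/-- The number of edges at `u` inserted by a batch. -/
def incident (S : Batch V) (u : V) : ℕ := (S.ins.filter fun e => u ∈ e).card

/-- The number of edges at `u` inserted by the batches with numbers in `(a, b]`. -/
def insBetween (B : ℕ → Batch V) (u : V) (a b : ℕ) : ℕ := ∑ j ∈ Finset.Ioc a b, incident (B j) u

theorem sum_incident_le (S : Batch V) : ∑ u, incident S u ≤ 2 * S.size := by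
  classical
  have h : ∀ u, incident S u = ∑ e ∈ S.ins, if u ∈ e then 1 else 0 := by
    intro u
    rw [incident, Finset.card_filter]
  simp only [h]
  rw [Finset.sum_comm]
  calc ∑ e ∈ S.ins, ∑ u, (if u ∈ e then 1 else 0) ≤ ∑ e ∈ S.ins, 2 := by
        refine Finset.sum_le_sum fun e _ => ?_
        induction e using Sym2.ind with
        | _ x y =>
          rw [← Finset.card_filter]
          refine (Finset.card_le_card (t := {x, y}) fun u hu => ?_).trans Finset.card_le_two
          simpa using hu
    _ ≤ 2 * S.size := by
        rw [Finset.sum_const, smul_eq_mul, Batch.size]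
        omega

theorem incident_pos {S : Batch V} {u v : V} (h : s(u, v) ∈ S.ins) : 1 ≤ incident S u := by
  classical
  refine Finset.card_pos.2 ⟨s(u, v), ?_⟩
  simp [h]

theorem insBetween_succ (B : ℕ → Batch V) (u : V) {a b : ℕ} (h : a ≤ b) :
    insBetween B u a (b + 1) = insBetween B u a b + incident (B (b + 1)) u := by
  rw [insBetween, Finset.sum_Ioc_succ_top h, insBetween]

theorem insBetween_self (B : ℕ → Batch V) (u : V) (a : ℕ) : insBetween B u a a = 0 := by
  simp [insBetween]

open Classical in
/-- The vertices that get joined to `u` after batch `k`, as long as not more than `3 ^ i / 11664`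
edges at `u` have been inserted. -/
def partners (B : ℕ → Batch V) (u : V) (k i : ℕ) : Finset V :=
  {w | w ≠ u ∧ ∃ j > k, s(u, w) ∈ (B j).ins ∧ 11664 * insBetween B u k j ≤ 3 ^ i}

theorem card_partners_le (B : ℕ → Batch V) (u : V) (k i : ℕ) :
    11664 * (partners B u k i).card ≤ 3 ^ i := by
  classical
  rcases (partners B u k i).eq_empty_or_nonempty with h | h
  · simp [h]
  have hmem : ∀ w ∈ partners B u k i, ∃ j > k, s(u, w) ∈ (B j).ins ∧
      11664 * insBetween B u k j ≤ 3 ^ i := fun w hw => (Finset.mem_filter.1 hw).2.2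
  -- `f w` is a batch that joins `w` to `u`. For the partner with the latest such batch, all
  -- partners are counted among the insertions up to that batch, and its own membership caps their
  -- number.
  choose! f hf using hmem
  obtain ⟨w₀, hw₀, hmax⟩ := Finset.exists_max_image _ f h
  refine le_trans ?_ (hf w₀ hw₀).2.2
  gcongr
  have hsub : partners B u k i ⊆ (Finset.Ioc k (f w₀)).biUnion
      fun j => Finset.univ.filter fun w => s(u, w) ∈ (B j).ins := by
    intro w hw
    simp only [Finset.mem_biUnion, Finset.mem_Ioc, Finset.mem_filter, Finset.mem_univ, true_and]
    exact ⟨f w, ⟨(hf w hw).1, hmax w hw⟩, (hf w hw).2.1⟩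
  refine (Finset.card_le_card hsub).trans (Finset.card_biUnion_le.trans ?_)
  refine Finset.sum_le_sum fun j _ => ?_
  refine Finset.card_le_card_of_injOn (fun w => s(u, w)) ?_ ?_
  · intro w hw
    simpa using hw
  · intro w _ w' _ h
    exact Sym2.congr_right.1 h

/-! ## Potentials -/

open Classical in
/-- The neighbors of a vertex. -/
def nbrs (G : SimpleGraph V) (u : V) : Finset V := {v | G.Adj u v}

theorem nbrsUpTo_subset_nbrs (s : Config V Δ) (u : V) (k : ℕ) :
    s.nbrsUpTo u k ⊆ nbrs s.graph u := by
  classical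
  intro v hv
  simp only [Config.nbrsUpTo, nbrs, Finset.mem_filter, Finset.mem_univ, true_and] at hv ⊢
  exact hv.1

/-- The vertex `u`, last colored in batch `k` at level `i`, has the color of one of its partners,
which did not get it later. -/
def AtRisk (B : ℕ → Batch V) (s : Config V Δ) (u : V) (k i : ℕ) : Prop :=
  ∃ w ∈ partners B u k i, s.color w = s.color u ∧ (Mark.rand k i).AtLeastAsRecent (s.mark w)

open Classical in
/-- What a vertex with a random color that is not at risk has already spent. -/
def credit (B : ℕ → Batch V) (s : Config V Δ) (u : V) : ℕ :=
  match s.mark u with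
  | .det => 0
  | .rand k i => if 6 ≤ i ∧ s.color u ≠ none ∧ ¬ AtRisk B s u k i then 27 * 3 ^ i else 0

open Classical in
/-- The number of edges inserted at `u` since it got its random color. -/
def insSince (B : ℕ → Batch V) (k : ℕ) (s : Config V Δ) (u : V) : ℕ :=
  match s.mark u with
  | .det => 0
  | .rand k' _ => if s.color u ≠ none then insBetween B u k' k else 0

/-- The potential of a vertex after (or during) batch `k`. -/
def vertexPot (B : ℕ → Batch V) (k : ℕ) (s : Config V Δ) (u : V) : ℕ :=
  81 * insBetween B u 0 k - credit B s u + 314928 * insSince B k s u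

open Classical in
/-- The cost of the recoloring of a clean spawning vertex in the current batch; it is booked at the
beginning of the batch for a vertex at level at most `5`, otherwise when the vertex is colored. -/
def spawnCost (s : Config V Δ) (u : V) : ℕ :=
  if u ∈ s.spawned ∧ s.Clean u then
    if s.level u ≤ 5 then 3 ^ 7 else if s.color u ≠ none then 3 ^ (s.level u + 2) else 0
  else 0

/-- The potential between batches. -/
def batchPot (B : ℕ → Batch V) (k : ℕ) (s : Config V Δ) : ℕ := ccCost s + ∑ u, vertexPot B k s u

/-- The potential within a batch. -/
def phasePot (B : ℕ → Batch V) (k : ℕ) (s : Config V Δ) : ℕ :=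
  ccCost s + ∑ u, (vertexPot B k s u + spawnCost s u)

theorem vertexPot_of_color_eq_none (B : ℕ → Batch V) (k : ℕ) {s : Config V Δ} {u : V}
    (h : s.color u = none) : vertexPot B k s u = 81 * insBetween B u 0 k := by
  unfold vertexPot credit insSince
  cases s.mark u <;> simp [h]

theorem vertexPot_of_mark_eq_det (B : ℕ → Batch V) (k : ℕ) {s : Config V Δ} {u : V}
    (h : s.mark u = .det) : vertexPot B k s u = 81 * insBetween B u 0 k := by
  simp [vertexPot, credit, insSince, h]

/-- Credit can only be lost by a new risk. The hypothesis `h` excludes this: a vertex that shares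
the color of `u` and is marked no later than `u` in `t` already did so in `s`. -/
theorem credit_le_credit {B : ℕ → Batch V} {s t : Config V Δ} {u : V}
    (hc : t.color u = s.color u) (hm : t.mark u = s.mark u)
    (h : ∀ w, s.mark u ≠ .det → t.color w ≠ none → t.color w = t.color u →
      (s.mark u).AtLeastAsRecent (t.mark w) → s.color w = t.color w ∧ s.mark w = t.mark w) :
    credit B s u ≤ credit B t u := by
  unfold credit
  rw [hm, hc]
  cases hmu : s.mark u with
  | det => simp
  | rand k i =>
    dsimp only
    by_cases h1 : 6 ≤ i ∧ s.color u ≠ none ∧ ¬ AtRisk B s u k i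
    · rw [if_pos h1, if_pos]
      refine ⟨h1.1, h1.2.1, ?_⟩
      rintro ⟨w, hw, hwu, hrec⟩
      obtain ⟨h2, h3⟩ := h w (by simp [hmu]) (by rw [hwu, hc]; exact h1.2.1) hwu (hmu ▸ hrec)
      exact h1.2.2 ⟨w, hw, by rw [h2, hwu, hc], by rw [h3]; exact hrec⟩
    · rw [if_neg h1]
      exact Nat.zero_le _

theorem vertexPot_le_vertexPot {B : ℕ → Batch V} {k : ℕ} {s t : Config V Δ} {u : V}
    (hc : t.color u = s.color u) (hm : t.mark u = s.mark u)
    (h : ∀ w, s.mark u ≠ .det → t.color w ≠ none → t.color w = t.color u →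
      (s.mark u).AtLeastAsRecent (t.mark w) → s.color w = t.color w ∧ s.mark w = t.mark w) :
    vertexPot B k t u ≤ vertexPot B k s u := by
  have h1 := credit_le_credit (B := B) hc hm h
  have h2 : insSince B k t u = insSince B k s u := by simp only [insSince, hc, hm]
  unfold vertexPot
  rw [h2]
  omega

/-! ## Invariants -/

/-- Levels stay in their range and are paid for by insertions. -/
structure LevelInv (B : ℕ → Batch V) (k : ℕ) (s : Config V Δ) : Prop where
  five_le : ∀ u, 5 ≤ s.level u
  le_numLevels : ∀ u, s.level u ≤ numLevels Δ
  pow_le : ∀ u, 6 ≤ s.level u → 3 ^ s.level u ≤ 3 * insBetween B u 0 k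

/-- The invariant between batches, after batch number `k`. -/
structure BatchInv (B : ℕ → Batch V) (k : ℕ) (s : Config V Δ) : Prop where
  level : LevelInv B k s
  card_nbrs_le : ∀ u, (nbrs s.graph u).card ≤ insBetween B u 0 k
  mark : ∀ u k' i, s.color u ≠ none → s.mark u = .rand k' i → s.level u = i ∧ k' ≤ k

/-- The invariant of the coloring phase of batch `k`, when the levels below `b` remain to be
colored. -/
structure ColorInv (B : ℕ → Batch V) (k b : ℕ) (s : Config V Δ) : Prop where
  level : LevelInv B k s
  card_nbrs_le : ∀ u, (nbrs s.graph u).card ≤ insBetween B u 0 k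
  card_nbrs_le_delta : ∀ u, (nbrs s.graph u).card ≤ Δ
  batch : s.batch = k
  mark : ∀ u k' i, s.color u ≠ none → s.mark u = .rand k' i →
    s.level u = i ∧ (k' < k ∨ (k' = k ∧ b ≤ i))
  dirty : ∀ u ∈ s.blanked, ¬ s.Clean u → s.color u ≠ none → s.mark u = .det
  uncolored : ∀ u, s.color u = none → s.Clean u → s.level u < b

theorem insBetween_le_succ (B : ℕ → Batch V) (u : V) (a b : ℕ) :
    insBetween B u a (b + 1) ≤ insBetween B u a b + incident (B (b + 1)) u := by
  rcases le_or_gt a b with h | h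
  · exact (insBetween_succ B u h).le
  · simp [insBetween, Finset.Ioc_eq_empty_of_le (show b + 1 ≤ a from h)]

theorem card_nbrs_applyEdges_le (G : SimpleGraph V) (S : Batch V) (u : V) :
    (nbrs (applyEdges G S) u).card ≤ (nbrs G u).card + incident S u := by
  classical
  have hsub : nbrs (applyEdges G S) u ⊆
      nbrs G u ∪ Finset.univ.filter fun w => s(u, w) ∈ S.ins := by
    intro w hw
    simp only [nbrs, applyEdges, Finset.mem_filter, Finset.mem_univ, true_and,
      SimpleGraph.fromEdgeSet_adj, Set.mem_union, Set.mem_sdiff, SimpleGraph.mem_edgeSet,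
      Finset.mem_coe, Finset.mem_union] at hw ⊢
    tauto
  refine (Finset.card_le_card hsub).trans ((Finset.card_union_le _ _).trans ?_)
  gcongr
  refine Finset.card_le_card_of_injOn (fun w => s(u, w)) ?_ ?_
  · intro w hw
    simpa using hw
  · intro w _ w' _ h
    exact Sym2.congr_right.1 h

theorem card_nbrs_eq_ncard (G : SimpleGraph V) (u : V) :
    (nbrs G u).card = (G.neighborSet u).ncard := by
  classical
  rw [← Set.ncard_coe_finset]
  congr 1
  ext v
  simp [nbrs]

/-! ## The initialization phase -/

theorem BatchInv.initPhase {B : ℕ → Batch V} {k : ℕ} {s : Config V Δ} (hs : BatchInv B k s)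
    (hΔ : ∀ v, ((applyEdges s.graph (B (k + 1))).neighborSet v).ncard ≤ Δ) :
    ColorInv B (k + 1) (numLevels Δ + 1) (initPhase (k + 1) (B (k + 1)) s) := by
  classical
  constructor
  · exact ⟨hs.level.five_le, hs.level.le_numLevels, fun u hu => (hs.level.pow_le u hu).trans
      (by rw [insBetween_succ B u (Nat.zero_le k)]; omega)⟩
  · intro u
    rw [insBetween_succ B u (Nat.zero_le k)]
    exact (card_nbrs_applyEdges_le _ _ u).trans (by gcongr; exact hs.card_nbrs_le u)
  · intro u
    rw [card_nbrs_eq_ncard]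
    exact hΔ u
  · rfl
  · intro u k' i hc hm
    have hc' : s.color u ≠ none := by
      intro h
      apply hc
      simp [DynColoring.initPhase, h]
    obtain ⟨h1, h2⟩ := hs.mark u k' i hc' hm
    exact ⟨h1, Or.inl (by omega)⟩
  · intro u hu _ hc
    exact absurd (if_pos hu) hc
  · intro u _ _
    exact Nat.lt_succ_of_le (hs.level.le_numLevels u)

/-- The constant is `81 + 2187 + 314928`: growth of the budget, the cost `3^7` booked in advance at
level `5`, and the charge that repays the credit of a vertex uncolored by an insertion. -/
theorem vertexPot_initPhase_le {B : ℕ → Batch V} {k : ℕ} {s : Config V Δ} (hs : BatchInv B k s)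
    (hB : ∀ e ∈ (B (k + 1)).ins, ¬ e.IsDiag) (u : V) :
    vertexPot B (k + 1) (initPhase (k + 1) (B (k + 1)) s) u +
        spawnCost (initPhase (k + 1) (B (k + 1)) s) u ≤
      vertexPot B k s u + 317196 * incident (B (k + 1)) u := by
  classical
  set t := initPhase (k + 1) (B (k + 1)) s with ht
  have hI := insBetween_succ B u (Nat.zero_le k)
  have hmark : t.mark = s.mark := rfl
  have hcol : ∀ v, t.color v = if v ∈ t.spawned then none else s.color v := fun v => rfl
  -- The credit never exceeds the budget, so the truncated subtraction in `vertexPot` is exact.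
  have hcredit : credit B s u ≤ 81 * insBetween B u 0 k := by
    unfold credit
    cases hm : s.mark u with
    | det => simp
    | rand k' i =>
      dsimp only
      split_ifs with h
      · obtain ⟨h1, h2⟩ := hs.mark u k' i h.2.1 hm
        have := hs.level.pow_le u (h1 ▸ h.1)
        rw [h1] at this
        omega
      · simp
  by_cases hu : u ∈ t.spawned
  · have hcu : t.color u = none := by rw [hcol, if_pos hu]
    rw [vertexPot_of_color_eq_none B _ hcu, hI]
    have hu' := hu
    simp only [ht, initPhase, Finset.mem_filter, Finset.mem_univ, true_and] at hu'
    obtain ⟨v, hv, hcv, hrec⟩ := hu'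
    have hinc := incident_pos hv
    have hcost : spawnCost t u ≤ 2187 * incident (B (k + 1)) u := by
      unfold spawnCost
      split_ifs with h1 h2 h3
      · omega
      · exact absurd hcu h3
      · simp
      · simp
    have hpot : 81 * insBetween B u 0 k ≤
        vertexPot B k s u + 314928 * incident (B (k + 1)) u := by
      unfold vertexPot
      cases hm : s.mark u with
      | det => simp [credit, hm]; omega
      | rand k' i =>
        by_cases h : 6 ≤ i ∧ s.color u ≠ none ∧ ¬ AtRisk B s u k' i
        · obtain ⟨h1, h2⟩ := hs.mark u k' i h.2.1 hm
          have hcr : credit B s u = 27 * 3 ^ i := by simp [credit, hm, h]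
          have hsi : insSince B k s u = insBetween B u k' k := by simp [insSince, hm, h.2.1]
          rw [hm] at hrec
          -- If few edges had been inserted since the coloring, `v` would be a partner with the same
          -- color and a mark no more recent than that of `u`; then `u` would be at risk, against
          -- `h`. So the insertions since the coloring repay the credit, as `314928 = 27 * 11664`.
          have hlong : 3 ^ i < 11664 * insBetween B u k' (k + 1) := by
            by_contra! hle
            by_cases hvu : v = u
            · subst hvu
              exact hB _ hv rfl
            · exact h.2.2 ⟨v, by
                simp only [partners, Finset.mem_filter, Finset.mem_univ, true_and]
                exact ⟨hvu, k + 1, by omega, hv, hle⟩, hcv.symm, hrec⟩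
          rw [insBetween_succ B u h2] at hlong
          rw [hcr] at hcredit ⊢
          rw [hsi]
          omega
        · have hcr : credit B s u = 0 := by simp only [credit, hm, if_neg h]
          rw [hcr]
          omega
    omega
  · have hcu : t.color u = s.color u := by rw [hcol, if_neg hu]
    have hcost : spawnCost t u = 0 := by simp [spawnCost, hu]
    -- The initialization only removes colors, which creates no new risk.
    have hcr : credit B s u ≤ credit B t u := by
      refine credit_le_credit hcu rfl fun w _ hw hwu _ => ⟨?_, rfl⟩
      rw [hcol] at hw hwu ⊢
      split_ifs at hw hwu ⊢ with h1
      · exact absurd rfl hw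
      · rfl
    have hsi : insSince B (k + 1) t u ≤ insSince B k s u + incident (B (k + 1)) u := by
      unfold insSince
      rw [hmark]
      cases s.mark u with
      | det => simp
      | rand k' i =>
        dsimp only
        rw [hcu]
        split_ifs
        · exact insBetween_le_succ B u k' k
        · simp
    unfold vertexPot
    rw [hcost, hI]
    omega

theorem phasePot_initPhase_le {B : ℕ → Batch V} {k : ℕ} {s : Config V Δ} (hs : BatchInv B k s)
    (hB : ∀ e ∈ (B (k + 1)).ins, ¬ e.IsDiag) :
    phasePot B (k + 1) (initPhase (k + 1) (B (k + 1)) s) ≤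
      batchPot B k s + 634392 * (B (k + 1)).size := by
  unfold phasePot batchPot
  have h1 : ccCost (initPhase (k + 1) (B (k + 1)) s) = ccCost s := rfl
  have h2 := Finset.sum_le_sum fun u (_ : u ∈ Finset.univ) => vertexPot_initPhase_le hs hB u
  rw [Finset.sum_add_distrib (f := vertexPot B k s), ← Finset.mul_sum] at h2
  have h3 := sum_incident_le (B (k + 1))
  omega

/-! ## Coloring dirty vertices -/

/-- The parts of the state that the coloring phase does not change. -/
structure SameFrame (s t : Config V Δ) : Prop where
  graph : t.graph = s.graph
  level : t.level = s.level
  batch : t.batch = s.batch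
  spawned : t.spawned = s.spawned
  record : t.record = s.record

theorem SameFrame.refl (s : Config V Δ) : SameFrame s s := ⟨rfl, rfl, rfl, rfl, rfl⟩

theorem SameFrame.trans {s t r : Config V Δ} (h : SameFrame s t) (h' : SameFrame t r) :
    SameFrame s r :=
  ⟨h'.graph.trans h.graph, h'.level.trans h.level, h'.batch.trans h.batch,
    h'.spawned.trans h.spawned, h'.record.trans h.record⟩

theorem nbrsUpTo_congr {s t : Config V Δ} (hg : t.graph = s.graph) (hl : t.level = s.level)
    (u : V) (k : ℕ) : t.nbrsUpTo u k = s.nbrsUpTo u k := by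
  classical
  ext v
  simp only [Config.nbrsUpTo, hg, hl, Finset.mem_filter]

theorem clean_congr {s t : Config V Δ} (hg : t.graph = s.graph) (hl : t.level = s.level)
    (u : V) : t.Clean u ↔ s.Clean u := by
  simp only [Config.Clean, Config.Upper, Config.Lower, nbrsUpTo_congr hg hl, hl]

theorem SameFrame.clean_iff {s t : Config V Δ} (h : SameFrame s t) (u : V) :
    t.Clean u ↔ s.Clean u := clean_congr h.graph h.level u

theorem SameFrame.ccCost_eq {s t : Config V Δ} (h : SameFrame s t) : ccCost t = ccCost s := by
  simp only [ccCost, h.record]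

theorem SameFrame.spawnCost_le {s t : Config V Δ} (h : SameFrame s t) {u : V}
    (hc : s.Clean u → 5 < s.level u → t.color u ≠ none → s.color u ≠ none) :
    spawnCost t u ≤ spawnCost s u := by
  unfold spawnCost
  rw [h.spawned, h.level]
  by_cases h1 : u ∈ s.spawned ∧ s.Clean u
  · have h1' : u ∈ s.spawned ∧ t.Clean u := ⟨h1.1, (h.clean_iff u).2 h1.2⟩
    rw [if_pos h1, if_pos h1']
    by_cases h2 : s.level u ≤ 5
    · rw [if_pos h2, if_pos h2]
    · rw [if_neg h2, if_neg h2]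
      by_cases h3 : t.color u ≠ none
      · rw [if_pos h3, if_pos (hc h1.2 (by omega) h3)]
      · rw [if_neg h3]
        exact Nat.zero_le _
  · have h1' : ¬ (u ∈ s.spawned ∧ t.Clean u) := fun h2 => h1 ⟨h2.1, (h.clean_iff u).1 h2.2⟩
    rw [if_neg h1']
    exact Nat.zero_le _

/-- Some uncolored dirty vertices get a color and the mark `det`. -/
structure MarkedStep (s t : Config V Δ) : Prop where
  frame : SameFrame s t
  blanked : t.blanked = s.blanked
  vertex : ∀ u, (t.color u = s.color u ∧ t.mark u = s.mark u) ∨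
    (s.color u = none ∧ ¬ s.Clean u ∧ t.color u ≠ none ∧ t.mark u = .det)

theorem MarkedStep.commitMarked {s t : Config V Δ} (h : MarkedStep s t) (i : ℕ)
    (f : V → Option (Fin (Δ + 1))) : MarkedStep s (commitMarked i t f) := by
  classical
  refine ⟨h.frame.trans ⟨rfl, rfl, rfl, rfl, rfl⟩, h.blanked, fun u => ?_⟩
  by_cases hu : u ∈ accepted t (t.marked i) f
  · right
    have hc : (DynColoring.commitMarked i t f).color u = f u := if_pos hu
    have hm : (DynColoring.commitMarked i t f).mark u = .det := if_pos hu
    rw [hc, hm]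
    simp only [accepted, Config.marked, Finset.mem_filter, Finset.mem_univ, true_and] at hu
    have hcl : ¬ s.Clean u := by
      rw [← h.frame.clean_iff]
      exact hu.1.2.2
    refine ⟨?_, hcl, hu.2.1, rfl⟩
    rcases h.vertex u with h1 | h1
    · rw [← h1.1]
      exact hu.1.1
    · exact h1.1
  · have hc : (DynColoring.commitMarked i t f).color u = t.color u := if_neg hu
    have hm : (DynColoring.commitMarked i t f).mark u = t.mark u := if_neg hu
    rw [hc, hm]
    exact h.vertex u

/-- Only an invariant of the rounds is recorded; it is reflexive, so it holds whether or not the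
loop terminates. -/
theorem markedStep_of_mem_support {R : PaletteRule V Δ} {i : ℕ} {s t : Config V Δ}
    (h : t ∈ (colorMarked R i s).support) : MarkedStep s t := by
  classical
  refine whileLoop_support (Inv := MarkedStep s) ?_ ?_ t h
  · intro t ht _ t' ht'
    obtain ⟨f, _, rfl⟩ := (PMF.mem_support_map_iff _ _ _).1 ht'
    exact ht.commitMarked i f
  · exact ⟨⟨rfl, rfl, rfl, rfl, rfl⟩, rfl, fun u => Or.inl ⟨rfl, rfl⟩⟩

theorem LevelInv.congr {B : ℕ → Batch V} {k : ℕ} {s t : Config V Δ} (hs : LevelInv B k s)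
    (h : t.level = s.level) : LevelInv B k t := by
  constructor
  · rw [h]
    exact hs.five_le
  · rw [h]
    exact hs.le_numLevels
  · rw [h]
    exact hs.pow_le

theorem ColorInv.markedStep {B : ℕ → Batch V} {k b : ℕ} {s t : Config V Δ}
    (hs : ColorInv B k b s) (h : MarkedStep s t) : ColorInv B k b t := by
  refine ⟨hs.level.congr h.frame.level, ?_, ?_, h.frame.batch.trans hs.batch, ?_, ?_, ?_⟩
  · rw [h.frame.graph]
    exact hs.card_nbrs_le
  · rw [h.frame.graph]
    exact hs.card_nbrs_le_delta
  · intro u k' i hc hm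
    rw [h.frame.level]
    rcases h.vertex u with ⟨h1, h2⟩ | h1
    · exact hs.mark u k' i (h1 ▸ hc) (h2 ▸ hm)
    · simp [h1.2.2.2] at hm
  · intro u hu hcl hc
    rw [h.blanked] at hu
    rw [h.frame.clean_iff] at hcl
    rcases h.vertex u with ⟨h1, h2⟩ | h1
    · rw [h2]
      exact hs.dirty u hu hcl (h1 ▸ hc)
    · exact h1.2.2.2
  · intro u hc hcl
    rw [h.frame.clean_iff] at hcl
    rw [h.frame.level]
    rcases h.vertex u with ⟨h1, h2⟩ | h1
    · exact hs.uncolored u (h1 ▸ hc) hcl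
    · exact absurd hc h1.2.2.1

/-- An uncolored vertex and one marked `det` have the same potential, and dirty vertices carry no
spawn cost. A newly colored vertex puts nobody at risk, because no random mark is as recent as
`det`. -/
theorem MarkedStep.phasePot_le {B : ℕ → Batch V} {k : ℕ} {s t : Config V Δ}
    (h : MarkedStep s t) : phasePot B k t ≤ phasePot B k s := by
  unfold phasePot
  rw [h.frame.ccCost_eq]
  gcongr with u
  · rcases h.vertex u with ⟨h1, h2⟩ | h1
    · refine vertexPot_le_vertexPot h1 h2 fun w hd _ _ hrec => ?_
      rcases h.vertex w with h3 | h3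
      · exact ⟨h3.1.symm, h3.2.symm⟩
      · cases hm : s.mark u with
        | det => exact absurd hm hd
        | rand k' i =>
          rw [hm, h3.2.2.2] at hrec
          exact hrec.elim
    · rw [vertexPot_of_mark_eq_det B k h1.2.2.2, vertexPot_of_color_eq_none B k h1.1]
  · refine h.frame.spawnCost_le fun hcl _ hc => ?_
    rcases h.vertex u with h1 | h1
    · exact h1.1 ▸ hc
    · exact absurd hcl h1.2.1

/-! ## Palettes of clean vertices -/

/-- A color that is neither blank nor unique is used at or above the level of `u` (`X₁`, at most
`|U|` colors) or at least twice below it (`X₂`, at most `|W| / 2` colors). Since `|W| + |U| +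
deg_H(u) ≤ Δ`, at least `deg_H(u) + 1 + |W| / 2` of the `Δ + 1` colors remain, and the lower
condition bounds `|W|` from below. -/
theorem le_card_blank_union_unique (s : Config V Δ) (u : V) (H : Finset V)
    (hH : ∀ v ∈ H, s.color v = none ∧ s.level v = s.level u) (hu : s.Clean u)
    (h5 : 5 ≤ s.level u) (hΔ : (nbrs s.graph u).card ≤ Δ) :
    max ((s.nbrsIn H u).card + 1) (3 ^ (s.level u - 5) / 2 + 1) ≤
      (s.blankColors u ∪ s.uniqueColors u).card := by
  classical
  set N := nbrs s.graph u with hN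
  set W := N.filter fun v => s.level v < s.level u with hW
  set U := N.filter fun v => ¬ s.level v < s.level u ∧ s.color v ≠ none with hU
  set X₂ : Finset (Fin (Δ + 1)) :=
    Finset.univ.filter fun c => 2 ≤ (W.filter fun v => s.color v = some c).card with hX₂
  set X₁ : Finset (Fin (Δ + 1)) :=
    Finset.univ.filter fun c => ∃ v ∈ U, s.color v = some c with hX₁
  have hmemN : ∀ v, v ∈ N ↔ s.graph.Adj u v := fun v => by simp [hN, nbrs]
  have hcov : Finset.univ ⊆ (s.blankColors u ∪ s.uniqueColors u) ∪ (X₁ ∪ X₂) := by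
    intro c _
    by_contra hc
    simp only [Finset.mem_union, not_or, hX₁, hX₂, Finset.mem_filter, Finset.mem_univ, true_and,
      Config.blankColors, Config.uniqueColors, not_exists, not_and] at hc
    obtain ⟨⟨hb, hq⟩, h1, h2⟩ := hc
    have hup : ∀ v, s.graph.Adj u v → s.level u ≤ s.level v → s.color v ≠ some c := by
      intro v hv hl hcv
      exact h1 v (Finset.mem_filter.2 ⟨(hmemN v).2 hv, by omega, by simp [hcv]⟩) hcv
    push Not at hb
    obtain ⟨v, hv, hcv⟩ := hb
    have hlv : s.level v < s.level u := by
      by_contra! h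
      exact hup v hv h hcv
    apply hq hup
    refine ⟨v, ⟨hv, hlv, hcv⟩, ?_⟩
    rintro w ⟨hw, hlw, hcw⟩
    by_contra hne
    apply h2
    refine Finset.one_lt_card.2 ⟨v, ?_, w, ?_, fun h => hne h.symm⟩
    · simp [hW, hmemN, hv, hlv, hcv]
    · simp [hW, hmemN, hw, hlw, hcw]
  have hX₁c : X₁.card ≤ U.card := by
    have : X₁.card = (X₁.map Function.Embedding.some).card := (Finset.card_map _).symm
    rw [this]
    refine (Finset.card_le_card (t := U.image s.color) ?_).trans Finset.card_image_le
    intro o ho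
    obtain ⟨c, hc, rfl⟩ := Finset.mem_map.1 ho
    obtain ⟨v, hv, hcv⟩ := (Finset.mem_filter.1 hc).2
    exact Finset.mem_image.2 ⟨v, hv, hcv⟩
  have hX₂c : X₂.card * 2 ≤ W.card := by
    calc X₂.card * 2 ≤ ∑ c ∈ X₂, (W.filter fun v => s.color v = some c).card := by
          rw [← smul_eq_mul]
          exact Finset.card_nsmul_le_sum _ _ _ fun c hc => (Finset.mem_filter.1 hc).2
      _ = (X₂.biUnion fun c => W.filter fun v => s.color v = some c).card := by
          rw [Finset.card_biUnion]
          intro c _ d _ hcd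
          refine Finset.disjoint_left.2 fun v hv hv' => hcd ?_
          exact Option.some.inj ((Finset.mem_filter.1 hv).2.symm.trans (Finset.mem_filter.1 hv').2)
      _ ≤ W.card := by
          refine Finset.card_le_card fun v hv => ?_
          obtain ⟨c, _, hv⟩ := Finset.mem_biUnion.1 hv
          exact (Finset.mem_filter.1 hv).1
  have hsum : W.card + U.card + (s.nbrsIn H u).card ≤ N.card := by
    have hd1 : Disjoint W U := by
      refine Finset.disjoint_left.2 fun v hv hv' => ?_
      exact (Finset.mem_filter.1 hv').2.1 (Finset.mem_filter.1 hv).2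
    have hd2 : Disjoint (W ∪ U) (s.nbrsIn H u) := by
      refine Finset.disjoint_left.2 fun v hv hv' => ?_
      have h1 := hH v (Finset.mem_filter.1 hv').1
      rcases Finset.mem_union.1 hv with h2 | h2
      · have := (Finset.mem_filter.1 h2).2
        omega
      · exact (Finset.mem_filter.1 h2).2.2 h1.1
    rw [← Finset.card_union_of_disjoint hd1, ← Finset.card_union_of_disjoint hd2]
    refine Finset.card_le_card fun v hv => ?_
    rcases Finset.mem_union.1 hv with h2 | h2
    · rcases Finset.mem_union.1 h2 with h2 | h2 <;> exact (Finset.mem_filter.1 h2).1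
    · exact (hmemN v).2 (Finset.mem_filter.1 h2).2
  -- At level `5`, where the lower condition is void, the left side is `1 / 2 = 0`.
  have hlow : 3 ^ (s.level u - 5) / 2 ≤ W.card / 2 := by
    rcases h5.eq_or_lt with h | h
    · simp [← h]
    · refine Nat.div_le_div_right ((hu.2 h).trans (Finset.card_le_card fun v hv => ?_))
      have hv' := (Finset.mem_filter.1 hv).2
      exact Finset.mem_filter.2 ⟨(hmemN v).2 hv'.1, by omega⟩
  have htot : Δ + 1 ≤ (s.blankColors u ∪ s.uniqueColors u).card + (X₁.card + X₂.card) := by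
    calc Δ + 1 = (Finset.univ : Finset (Fin (Δ + 1))).card := by simp
      _ ≤ _ := Finset.card_le_card hcov
      _ ≤ _ := (Finset.card_union_le _ _).trans (by gcongr; exact Finset.card_union_le _ _)
  omega

/-! ## A round of list coloring -/

/-- Every palette of a vertex `u` in `H` has more than `deg_H(u)` colors. -/
def LargePalettes (s : Config V Δ) (H : Finset V) (P : V → Finset (Fin (Δ + 1))) : Prop :=
  ∀ u ∈ H, (s.nbrsIn H u).card + 1 ≤ (P u).card

theorem LargePalettes.nonempty {s : Config V Δ} {H : Finset V} {P : V → Finset (Fin (Δ + 1))}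
    (hP : LargePalettes s H P) {u : V} (hu : u ∈ H) : (P u).Nonempty :=
  Finset.card_pos.1 (lt_of_lt_of_le (Nat.succ_pos _) (hP u hu))

theorem LargePalettes.card_proposalSet {s : Config V Δ} {H : Finset V}
    {P : V → Finset (Fin (Δ + 1))} (hP : LargePalettes s H P) {u : V} (hu : u ∈ H) :
    (proposalSet H P u).card = (P u).card := by
  rw [proposalSet, if_pos ⟨hu, hP.nonempty hu⟩, Finset.card_map]

theorem LargePalettes.exists_eq_some {s : Config V Δ} {H : Finset V}
    {P : V → Finset (Fin (Δ + 1))} (hP : LargePalettes s H P) {f : V → Option (Fin (Δ + 1))}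
    (hf : ∀ v, f v ∈ proposalSet H P v) {u : V} (hu : u ∈ H) : ∃ c ∈ P u, f u = some c := by
  have h := hf u
  rw [proposalSet, if_pos ⟨hu, hP.nonempty hu⟩] at h
  obtain ⟨c, hc, hfc⟩ := Finset.mem_map.1 h
  exact ⟨c, hc, hfc.symm⟩

open Classical in
/-- All possible proposals in a round. -/
def proposals (H : Finset V) (P : V → Finset (Fin (Δ + 1))) :
    Finset (V → Option (Fin (Δ + 1))) := Fintype.piFinset (proposalSet H P)

theorem mem_proposals {H : Finset V} {P : V → Finset (Fin (Δ + 1))}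
    {f : V → Option (Fin (Δ + 1))} : f ∈ proposals H P ↔ ∀ v, f v ∈ proposalSet H P v := by
  classical
  simp [proposals]

theorem mem_support_propose {H : Finset V} {P : V → Finset (Fin (Δ + 1))}
    {f : V → Option (Fin (Δ + 1))} : f ∈ (propose H P).support ↔ f ∈ proposals H P := by
  simp [propose, proposals]

theorem expect_propose_le (H : Finset V) (P : V → Finset (Fin (Δ + 1)))
    (g : (V → Option (Fin (Δ + 1))) → ℕ) (a b : ℕ) (hb : 0 < b)
    (h : b * ∑ f ∈ proposals H P, g f ≤ a * (proposals H P).card) :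
    expect (propose H P) g ≤ a / b :=
  expect_uniformOfFinset_le _ g a b hb h

open Classical in
theorem LargePalettes.card_proposals_le {s : Config V Δ} {H : Finset V}
    {P : V → Finset (Fin (Δ + 1))} (hP : LargePalettes s H P) {u : V} (hu : u ∈ H) :
    (proposals H P).card ≤ 4 * ((proposals H P).filter fun f => u ∈ accepted s H f).card := by
  have h := card_piFinset_le_four_mul (proposalSet H P) (proposalSet_nonempty H P) u
    (s.nbrsIn H u) (by simp [Config.nbrsIn])
    (by rw [hP.card_proposalSet hu]; exact (Nat.le_succ _).trans (hP u hu))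
    -- A neighbor `v` of `u` in `H` has `u` as a neighbor in `H`, so its palette has at least two
    -- colors.
    (by
      intro v hv
      obtain ⟨hvH, hadj⟩ := Finset.mem_filter.1 hv
      rw [hP.card_proposalSet hvH]
      refine le_trans ?_ (hP v hvH)
      have : 0 < (s.nbrsIn H v).card :=
        Finset.card_pos.2 ⟨u, Finset.mem_filter.2 ⟨hu, hadj.symm⟩⟩
      omega)
  refine h.trans ?_
  gcongr 4 * ?_
  refine Finset.card_le_card fun f hf => ?_
  obtain ⟨hf, hne⟩ := Finset.mem_filter.1 hf
  refine Finset.mem_filter.2 ⟨hf, Finset.mem_filter.2 ⟨hu, ?_, ?_⟩⟩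
  · obtain ⟨c, _, hc⟩ := hP.exists_eq_some (mem_proposals.1 hf) hu
    simp [hc]
  · intro v hv hadj
    exact hne v (Finset.mem_filter.2 ⟨hv, hadj⟩)

open Classical in
theorem LargePalettes.four_mul_card_not_accepted_le {s : Config V Δ} {H : Finset V}
    {P : V → Finset (Fin (Δ + 1))} (hP : LargePalettes s H P) {u : V} (hu : u ∈ H) :
    4 * ((proposals H P).filter fun f => u ∉ accepted s H f).card ≤
      3 * (proposals H P).card := by
  have h1 := hP.card_proposals_le hu
  have h2 := Finset.card_filter_add_card_filter_not (s := proposals H P)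
    (fun f => u ∈ accepted s H f)
  omega

open Classical in
theorem LargePalettes.mul_card_filter_le {s : Config V Δ} {H : Finset V}
    {P : V → Finset (Fin (Δ + 1))} (hP : LargePalettes s H P) {u : V} (hu : u ∈ H) {m : ℕ}
    (hm : m ≤ (P u).card) (c : (V → Option (Fin (Δ + 1))) → Option (Fin (Δ + 1)))
    (hc : ∀ f x, c (Function.update f u x) = c f) :
    m * ((proposals H P).filter fun f => f u = c f).card ≤ (proposals H P).card := by
  have h := card_mul_card_filter_piFinset_le (proposalSet H P) u c hc
  rw [hP.card_proposalSet hu] at h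
  exact (Nat.mul_le_mul_right _ hm).trans h

/-! ## Coloring clean vertices -/

theorem card_unmarkedPalette (R : PaletteRule V Δ) {i : ℕ} (hi : 5 ≤ i) {s : Config V Δ}
    (hΔ : ∀ u, (nbrs s.graph u).card ≤ Δ) {u : V} (hu : u ∈ s.unmarked i) :
    (unmarkedPalette R i s u).card =
      max ((s.nbrsIn (s.unmarked i) u).card + 1) (3 ^ (i - 5) / 2 + 1) := by
  classical
  have hmem : ∀ v ∈ s.unmarked i, s.color v = none ∧ s.level v = i ∧ s.Clean v :=
    fun v hv => (Finset.mem_filter.1 hv).2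
  obtain ⟨_, hl, hcl⟩ := hmem u hu
  refine R.card_pick _ _ _ _ ?_
  have h := le_card_blank_union_unique s u (s.unmarked i)
    (fun v hv => ⟨(hmem v hv).1, (hmem v hv).2.1.trans hl.symm⟩) hcl (hl ▸ hi) (hΔ u)
  rw [hl] at h
  convert h

theorem largePalettes_unmarkedPalette (R : PaletteRule V Δ) {i : ℕ} (hi : 5 ≤ i)
    {s : Config V Δ} (hΔ : ∀ u, (nbrs s.graph u).card ≤ Δ) :
    LargePalettes s (s.unmarked i) (unmarkedPalette R i s) := by
  intro u hu
  rw [card_unmarkedPalette R hi hΔ hu]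
  exact le_max_left _ _

theorem mem_unmarked {s : Config V Δ} {i : ℕ} {u : V} :
    u ∈ s.unmarked i ↔ s.color u = none ∧ s.level u = i ∧ s.Clean u := by
  classical
  simp [Config.unmarked]

theorem mem_accepted {s : Config V Δ} {H : Finset V} {f : V → Option (Fin (Δ + 1))} {u : V} :
    u ∈ accepted s H f ↔ u ∈ H ∧ f u ≠ none ∧ ∀ v ∈ H, s.graph.Adj u v → f v ≠ f u := by
  classical
  simp [accepted]

section Commit

variable {i : ℕ} {s : Config V Δ} {f : V → Option (Fin (Δ + 1))} {u : V}

theorem commitUnmarked_frame : SameFrame s (commitUnmarked i s f) := ⟨rfl, rfl, rfl, rfl, rfl⟩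

theorem commitUnmarked_color_of_mem (h : u ∈ accepted s (s.unmarked i) f) :
    (commitUnmarked i s f).color u = f u := if_pos h

theorem commitUnmarked_color_of_notMem (h : u ∉ accepted s (s.unmarked i) f) :
    (commitUnmarked i s f).color u = s.color u ∨
      ((commitUnmarked i s f).color u = none ∧ s.color u ≠ none ∧ s.level u < i ∧
        ∃ v ∈ accepted s (s.unmarked i) f, s.graph.Adj v u ∧ s.level u < s.level v ∧
          s.color u = f v) := by
  classical
  have h1 : (commitUnmarked i s f).color u = _ := if_neg h
  rw [h1]
  split_ifs with h2
  · right
    simp only [Finset.mem_filter, Finset.mem_univ, true_and] at h2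
    obtain ⟨v, hv, hadj, hl, hc⟩ := h2
    have hv' := mem_accepted.1 hv
    refine ⟨rfl, ?_, ?_, v, hv, hadj, hl, hc⟩
    · rw [hc]
      exact hv'.2.1
    · rw [← (mem_unmarked.1 hv'.1).2.1]
      exact hl
  · exact Or.inl rfl

theorem commitUnmarked_color_eq_or (h : u ∉ accepted s (s.unmarked i) f) :
    (commitUnmarked i s f).color u = s.color u ∨ (commitUnmarked i s f).color u = none :=
  (commitUnmarked_color_of_notMem h).imp_right And.left

theorem commitUnmarked_mark_of_mem (h : u ∈ accepted s (s.unmarked i) f) :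
    (commitUnmarked i s f).mark u = .rand s.batch i := if_pos h

theorem commitUnmarked_mark_of_notMem (h : u ∉ accepted s (s.unmarked i) f) :
    (commitUnmarked i s f).mark u = s.mark u := if_neg h

theorem commitUnmarked_color_of_level (hl : i ≤ s.level u)
    (h : u ∉ accepted s (s.unmarked i) f) :
    (commitUnmarked i s f).color u = s.color u := by
  rcases commitUnmarked_color_of_notMem h with h1 | h1
  · exact h1
  · omega

/-- Colors are only taken from vertices strictly below level `i`, so the set to be colored just
loses the accepted vertices. -/
theorem mem_unmarked_commitUnmarked :
    u ∈ (commitUnmarked i s f).unmarked i ↔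
      u ∈ s.unmarked i ∧ u ∉ accepted s (s.unmarked i) f := by
  have hfr : SameFrame s (commitUnmarked i s f) := commitUnmarked_frame
  rw [mem_unmarked, mem_unmarked, hfr.clean_iff, hfr.level]
  by_cases h : u ∈ accepted s (s.unmarked i) f
  · rw [commitUnmarked_color_of_mem h]
    have := (mem_accepted.1 h).2.1
    tauto
  · constructor
    · rintro ⟨h1, h2, h3⟩
      rw [commitUnmarked_color_of_level h2.ge h] at h1
      exact ⟨⟨h1, h2, h3⟩, h⟩
    · rintro ⟨⟨h1, h2, h3⟩, -⟩
      rw [← commitUnmarked_color_of_level h2.ge h] at h1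
      exact ⟨h1, h2, h3⟩

end Commit

/-! ### Termination -/

theorem expect_card_unmarked_le (R : PaletteRule V Δ) {i : ℕ} (hi : 5 ≤ i) {s : Config V Δ}
    (hΔ : ∀ u, (nbrs s.graph u).card ≤ Δ) :
    expect ((propose (s.unmarked i) (unmarkedPalette R i s)).map (commitUnmarked i s))
      (fun t => (t.unmarked i).card) ≤ 3 / 4 * ((s.unmarked i).card : ℕ) := by
  classical
  have hP := largePalettes_unmarkedPalette R hi hΔ
  rw [expect_map]
  refine (expect_propose_le _ _ _ (3 * (s.unmarked i).card) 4 (by norm_num) ?_).trans ?_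
  · have h1 : ∀ f, ((commitUnmarked i s f).unmarked i).card =
        ∑ u ∈ s.unmarked i, if u ∉ accepted s (s.unmarked i) f then 1 else 0 := by
      intro f
      rw [← Finset.card_filter]
      congr 1
      ext u
      rw [mem_unmarked_commitUnmarked, Finset.mem_filter]
    simp only [h1]
    rw [Finset.sum_comm, Finset.mul_sum]
    calc _ ≤ ∑ u ∈ s.unmarked i, 3 * (proposals (s.unmarked i) (unmarkedPalette R i s)).card := by
          refine Finset.sum_le_sum fun u hu => ?_
          rw [← Finset.card_filter]
          exact hP.four_mul_card_not_accepted_le hu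
      _ = _ := by
          rw [Finset.sum_const, smul_eq_mul]
          ring
  · push_cast
    rw [ENNReal.div_eq_inv_mul, ENNReal.div_eq_inv_mul, mul_assoc]

/-! ### Collisions with partners -/

open Classical in
/-- A bound for the chance, scaled by `m`, that `u` and `w` end the loop with the same color. -/
def pairPot (i m : ℕ) (u w : V) (s : Config V Δ) : ℕ :=
  4 * ((if u ∈ s.unmarked i then 1 else 0) + (if w ∈ s.unmarked i then 1 else 0)) +
    m * (if s.color u ≠ none ∧ s.color w = s.color u then 1 else 0)

/-- A supermartingale. Each of `u`, `w` that is uncolored holds `4` and loses at least `1` of it in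
expectation, since it is accepted with probability at least `1/4`. A collision created in this round
has probability at most `1 / m`, because a proposal must hit the other's color or proposal; it
therefore costs at most `1`. Once neither is in `H`, no collision can arise, as `u` keeps its color
and `w` can only lose its own. -/
theorem expect_pairPot_le (R : PaletteRule V Δ) {i m : ℕ} (hi : 5 ≤ i)
    (hm : m ≤ 3 ^ (i - 5) / 2 + 1) {s : Config V Δ} (hΔ : ∀ u, (nbrs s.graph u).card ≤ Δ)
    {u w : V} (huw : w ≠ u) (hl : s.level u = i) :
    expect ((propose (s.unmarked i) (unmarkedPalette R i s)).map (commitUnmarked i s))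
      (pairPot i m u w) ≤ pairPot i m u w s := by
  classical
  set H := s.unmarked i with hH
  set P := unmarkedPalette R i s with hPdef
  have hP : LargePalettes s H P := largePalettes_unmarkedPalette R hi hΔ
  have hmP : ∀ x ∈ H, m ≤ (P x).card := by
    intro x hx
    rw [hPdef, card_unmarkedPalette R hi hΔ hx]
    exact hm.trans (le_max_right _ _)
  have hLH : ∀ f x, x ∈ accepted s H f → x ∈ H := fun f x hx => (mem_accepted.1 hx).1
  rw [expect_map]
  have key : 1 * ∑ f ∈ proposals H P, pairPot i m u w (commitUnmarked i s f) ≤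
      pairPot i m u w s * (proposals H P).card := by
    rw [one_mul]
    by_cases hu : u ∈ H <;> by_cases hw : w ∈ H
    · have hcu := (mem_unmarked.1 hu).1
      have hcw := (mem_unmarked.1 hw).1
      have hpt : ∀ f, pairPot i m u w (commitUnmarked i s f) ≤
          4 * (if u ∉ accepted s H f then 1 else 0) +
          4 * (if w ∉ accepted s H f then 1 else 0) + m * (if f u = f w then 1 else 0) := by
        intro f
        unfold pairPot
        simp only [mem_unmarked_commitUnmarked, ← hH, hu, hw, true_and]
        rw [mul_add]
        gcongr
        split_ifs with h1 h2 h2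
        · exact le_rfl
        · exfalso
          have hu' : u ∈ accepted s H f := by
            by_contra hn
            rw [commitUnmarked_color_of_level hl.ge hn] at h1
            exact h1.1 hcu
          have hw' : w ∈ accepted s H f := by
            by_contra hn
            rw [commitUnmarked_color_of_level (mem_unmarked.1 hw).2.1.ge hn] at h1
            exact h1.1 (h1.2 ▸ hcw)
          rw [commitUnmarked_color_of_mem hu', commitUnmarked_color_of_mem hw'] at h1
          exact h2 h1.2.symm
        · exact Nat.zero_le _
        · exact le_rfl
      refine (Finset.sum_le_sum fun f _ => hpt f).trans ?_
      simp only [Finset.sum_add_distrib, ← Finset.mul_sum, ← Finset.card_filter]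
      have h1 := hP.four_mul_card_not_accepted_le hu
      have h2 := hP.four_mul_card_not_accepted_le hw
      have h3 := hP.mul_card_filter_le hu (hmP u hu) (fun f => f w)
        (fun f x => by simp [huw])
      -- The three terms contribute at most `3 + 3 + 1`, in units of the number of proposals.
      have h4 : 8 ≤ pairPot i m u w s := by
        simp [pairPot, ← hH, hu, hw]
      calc _ ≤ 8 * (proposals H P).card := by omega
        _ ≤ _ := Nat.mul_le_mul_right _ h4
    · have hcu := (mem_unmarked.1 hu).1
      have hpt : ∀ f, pairPot i m u w (commitUnmarked i s f) ≤
          4 * (if u ∉ accepted s H f then 1 else 0) +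
          m * (if f u = s.color w then 1 else 0) := by
        intro f
        unfold pairPot
        simp only [mem_unmarked_commitUnmarked, ← hH, hu, hw, true_and, false_and, if_false,
          add_zero]
        gcongr
        split_ifs with h1 h2 h2
        · exact le_rfl
        · exfalso
          have hu' : u ∈ accepted s H f := by
            by_contra hn
            rw [commitUnmarked_color_of_level hl.ge hn] at h1
            exact h1.1 hcu
          rcases commitUnmarked_color_eq_or (fun h => hw (hLH f w h)) with h3 | h3
          · rw [h3, commitUnmarked_color_of_mem hu'] at h1
            exact h2 h1.2.symm
          · exact h1.1 (h1.2 ▸ h3)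
        · exact Nat.zero_le _
        · exact le_rfl
      refine (Finset.sum_le_sum fun f _ => hpt f).trans ?_
      simp only [Finset.sum_add_distrib, ← Finset.mul_sum, ← Finset.card_filter]
      have h1 := hP.four_mul_card_not_accepted_le hu
      have h3 := hP.mul_card_filter_le hu (hmP u hu) (fun _ => s.color w) (fun f x => rfl)
      have h4 : 4 ≤ pairPot i m u w s := by
        simp [pairPot, ← hH, hu, hw]
      calc _ ≤ 4 * (proposals H P).card := by omega
        _ ≤ _ := Nat.mul_le_mul_right _ h4
    · have hcw := (mem_unmarked.1 hw).1
      have hun : ∀ f, u ∉ accepted s H f := fun f h => hu (hLH f u h)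
      have hpt : ∀ f, pairPot i m u w (commitUnmarked i s f) ≤
          4 * (if w ∉ accepted s H f then 1 else 0) +
          m * (if f w = s.color u then 1 else 0) := by
        intro f
        unfold pairPot
        simp only [mem_unmarked_commitUnmarked, ← hH, hu, hw, true_and, false_and, if_false,
          zero_add]
        gcongr
        split_ifs with h1 h2 h2
        · exact le_rfl
        · exfalso
          rw [commitUnmarked_color_of_level hl.ge (hun f)] at h1
          have hw' : w ∈ accepted s H f := by
            by_contra hn
            rw [commitUnmarked_color_of_level (mem_unmarked.1 hw).2.1.ge hn] at h1
            exact h1.1 (h1.2 ▸ hcw)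
          rw [commitUnmarked_color_of_mem hw'] at h1
          exact h2 h1.2
        · exact Nat.zero_le _
        · exact le_rfl
      refine (Finset.sum_le_sum fun f _ => hpt f).trans ?_
      simp only [Finset.sum_add_distrib, ← Finset.mul_sum, ← Finset.card_filter]
      have h1 := hP.four_mul_card_not_accepted_le hw
      have h3 := hP.mul_card_filter_le hw (hmP w hw) (fun _ => s.color u) (fun f x => rfl)
      have h4 : 4 ≤ pairPot i m u w s := by
        simp [pairPot, ← hH, hu, hw]
      calc _ ≤ 4 * (proposals H P).card := by omega
        _ ≤ _ := Nat.mul_le_mul_right _ h4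
    · have hpt : ∀ f, pairPot i m u w (commitUnmarked i s f) ≤ pairPot i m u w s := by
        intro f
        have hun : u ∉ accepted s H f := fun h => hu (hLH f u h)
        have hwn : w ∉ accepted s H f := fun h => hw (hLH f w h)
        unfold pairPot
        simp only [mem_unmarked_commitUnmarked, ← hH, hu, hw, false_and]
        rw [commitUnmarked_color_of_level hl.ge hun]
        gcongr
        split_ifs with h1 h2 h2
        · exact le_rfl
        · exfalso
          rcases commitUnmarked_color_eq_or hwn with h3 | h3
          · exact h2 ⟨h1.1, h3 ▸ h1.2⟩
          · exact h1.1 (h1.2 ▸ h3)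
        · exact Nat.zero_le _
        · exact le_rfl
      refine (Finset.sum_le_sum fun f _ => hpt f).trans ?_
      rw [Finset.sum_const, smul_eq_mul, mul_comm]
  refine (expect_propose_le _ _ _ _ 1 one_pos key).trans ?_
  simp

/-! ### The effect of the loop on clean vertices -/

open Classical in
/-- Uncolored clean vertices at level `i` get a color, and at most as many vertices at lower levels
lose theirs. -/
structure UnmarkedStep (i : ℕ) (s t : Config V Δ) : Prop where
  frame : SameFrame s t
  blanked : ∀ u ∈ t.blanked, u ∈ s.blanked ∨ (t.color u = none ∧ s.level u < i)
  vertex : ∀ u, (t.color u = s.color u ∧ t.mark u = s.mark u) ∨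
    (u ∈ s.unmarked i ∧ t.color u ≠ none ∧ t.mark u = .rand s.batch i) ∨
    (s.color u ≠ none ∧ s.level u < i ∧ t.color u = none)
  card_le : (Finset.univ.filter fun v => s.color v ≠ none ∧ t.color v = none).card ≤
    ((s.unmarked i).filter fun u => t.color u ≠ none).card

theorem UnmarkedStep.refl (i : ℕ) (s : Config V Δ) : UnmarkedStep i s s := by
  classical
  refine ⟨SameFrame.refl s, fun u hu => Or.inl hu, fun u => Or.inl ⟨rfl, rfl⟩, ?_⟩
  rw [Finset.filter_false_of_mem]
  · simp
  · rintro v - ⟨h1, h2⟩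
    exact h1 h2

/-- The point is `card_le`: a kept color is blank or unique, so each vertex colored in this round
uncolors at most one lower neighbor. -/
theorem UnmarkedStep.commitUnmarked {R : PaletteRule V Δ} {i : ℕ} {s t : Config V Δ}
    (h : UnmarkedStep i s t) (hi : 5 ≤ i) (hΔ : ∀ u, (nbrs s.graph u).card ≤ Δ)
    {f : V → Option (Fin (Δ + 1))}
    (hf : f ∈ proposals (t.unmarked i) (unmarkedPalette R i t)) :
    UnmarkedStep i s (commitUnmarked i t f) := by
  classical
  set L := accepted t (t.unmarked i) f with hL
  have hfr : SameFrame s (DynColoring.commitUnmarked i t f) :=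
    h.frame.trans commitUnmarked_frame
  have hLs : ∀ u ∈ L, t.color u = none ∧ u ∈ s.unmarked i := by
    intro u hu
    have hu' := mem_unmarked.1 (mem_accepted.1 hu).1
    refine ⟨hu'.1, ?_⟩
    rcases h.vertex u with h1 | h1 | h1
    · rw [mem_unmarked, ← h1.1, ← h.frame.level, ← h.frame.clean_iff]
      exact hu'
    · exact h1.1
    · have := hu'.2.1
      rw [h.frame.level] at this
      omega
  refine ⟨hfr, fun u hu => ?_, fun u => ?_, ?_⟩
  · by_cases huL : u ∈ L
    · rcases Finset.mem_union.1 hu with h1 | h1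
      · rcases h.blanked u h1 with h2 | h2
        · exact Or.inl h2
        · have := (mem_unmarked.1 (hLs u huL).2).2.1
          omega
      · simp only [Finset.mem_filter, Finset.mem_univ, true_and] at h1
        obtain ⟨v, hv, _, _, hc⟩ := h1
        rw [(hLs u huL).1] at hc
        exact absurd hc.symm (mem_accepted.1 hv).2.1
    · rcases Finset.mem_union.1 hu with h1 | h1
      · rcases h.blanked u h1 with h2 | h2
        · exact Or.inl h2
        · rcases commitUnmarked_color_eq_or huL with h3 | h3
          · exact Or.inr ⟨h3.trans h2.1, h2.2⟩
          · exact Or.inr ⟨h3, h2.2⟩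
      · refine Or.inr ⟨(if_neg huL).trans (if_pos h1), ?_⟩
        obtain ⟨v, hv, _, hl, _⟩ := (Finset.mem_filter.1 h1).2
        rw [(mem_unmarked.1 (mem_accepted.1 hv).1).2.1, h.frame.level] at hl
        exact hl
  · by_cases huL : u ∈ L
    · refine Or.inr (Or.inl ⟨(hLs u huL).2, ?_, ?_⟩)
      · rw [commitUnmarked_color_of_mem huL]
        exact (mem_accepted.1 huL).2.1
      · rw [commitUnmarked_mark_of_mem huL, h.frame.batch]
    · rw [commitUnmarked_mark_of_notMem huL]
      rcases commitUnmarked_color_of_notMem huL with h1 | ⟨h1, h2, h3, -⟩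
      · rw [h1]
        exact h.vertex u
      · rw [h1]
        rw [h.frame.level] at h3
        rcases h.vertex u with h4 | h4 | h4
        · exact Or.inr (Or.inr ⟨h4.1 ▸ h2, h3, rfl⟩)
        · have := (mem_unmarked.1 h4.1).2.1
          omega
        · exact absurd h4.2.2 h2
  -- `A` collects the vertices that lose their color in this round.
  · set A := Finset.univ.filter fun v => v ∉ L ∧ t.color v ≠ none ∧
      (DynColoring.commitUnmarked i t f).color v = none with hA
    have hAL : A.card ≤ L.card := by
      have hsub : A ⊆ L.biUnion fun v => Finset.univ.filter fun u =>
          t.graph.Adj v u ∧ t.level u < t.level v ∧ t.color u = f v := by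
        intro u hu
        obtain ⟨huL, hcu, hcu'⟩ := (Finset.mem_filter.1 hu).2
        rcases commitUnmarked_color_of_notMem huL with h1 | ⟨-, -, -, v, hv, hadj, hl, hc⟩
        · exact absurd (h1 ▸ hcu') hcu
        · exact Finset.mem_biUnion.2 ⟨v, hv, by simp [hadj, hl, hc]⟩
      refine (Finset.card_le_card hsub).trans ?_
      refine (Finset.card_biUnion_le_card_mul _ _ 1 fun v hv => ?_).trans (mul_one _).le
      obtain ⟨c, hc, hfc⟩ := (largePalettes_unmarkedPalette R hi
        (by rw [h.frame.graph]; exact hΔ)).exists_eq_some (mem_proposals.1 hf) (mem_accepted.1 hv).1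
      have hc' := R.pick_subset _ _ _ _ hc
      refine Finset.card_le_one.2 fun x hx y hy => ?_
      obtain ⟨hx1, hx2, hx3⟩ := (Finset.mem_filter.1 hx).2
      obtain ⟨hy1, hy2, hy3⟩ := (Finset.mem_filter.1 hy).2
      rw [hfc] at hx3 hy3
      rcases Finset.mem_union.1 hc' with h1 | h1
      · exact absurd hx3 ((Finset.mem_filter.1 h1).2 x hx1)
      · exact (Finset.mem_filter.1 h1).2.2.unique ⟨hx1, hx2, hx3⟩ ⟨hy1, hy2, hy3⟩
    have h1 : (Finset.univ.filter fun v => s.color v ≠ none ∧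
        (DynColoring.commitUnmarked i t f).color v = none).card ≤
        (Finset.univ.filter fun v => s.color v ≠ none ∧ t.color v = none).card + A.card := by
      refine (Finset.card_le_card fun v hv => ?_).trans (Finset.card_union_le _ _)
      simp only [hA, Finset.mem_union, Finset.mem_filter, Finset.mem_univ, true_and] at hv ⊢
      by_cases hvt : t.color v = none
      · exact Or.inl ⟨hv.1, hvt⟩
      · exact Or.inr ⟨fun hvL => hvt (hLs v hvL).1, hvt, hv.2⟩
    have h2 : ((s.unmarked i).filter fun u => t.color u ≠ none).card + L.card ≤
        ((s.unmarked i).filter fun u =>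
          (DynColoring.commitUnmarked i t f).color u ≠ none).card := by
      rw [← Finset.card_union_of_disjoint]
      · refine Finset.card_le_card fun u hu => ?_
        rcases Finset.mem_union.1 hu with hu | hu
        · obtain ⟨hu1, hu2⟩ := Finset.mem_filter.1 hu
          refine Finset.mem_filter.2 ⟨hu1, ?_⟩
          rw [commitUnmarked_color_of_level]
          · exact hu2
          · rw [h.frame.level]
            exact (mem_unmarked.1 hu1).2.1.ge
          · exact fun hu3 => hu2 (hLs u hu3).1
        · refine Finset.mem_filter.2 ⟨(hLs u hu).2, ?_⟩
          rw [commitUnmarked_color_of_mem hu]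
          exact (mem_accepted.1 hu).2.1
      · exact Finset.disjoint_left.2 fun u hu hu' => (Finset.mem_filter.1 hu).2 (hLs u hu').1
    have h3 := h.card_le
    omega

theorem ColorInv.unmarkedStep {B : ℕ → Batch V} {k i : ℕ} {s t : Config V Δ}
    (hs : ColorInv B k (i + 1) s) (h : UnmarkedStep i s t) (hdone : ¬ (t.unmarked i).Nonempty) :
    ColorInv B k i t := by
  refine ⟨hs.level.congr h.frame.level, ?_, ?_, h.frame.batch.trans hs.batch, ?_, ?_, ?_⟩
  · rw [h.frame.graph]
    exact hs.card_nbrs_le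
  · rw [h.frame.graph]
    exact hs.card_nbrs_le_delta
  · intro u k' j hc hm
    rw [h.frame.level]
    rcases h.vertex u with ⟨h1, h2⟩ | ⟨h1, h2, h3⟩ | h1
    · obtain ⟨h3, h4⟩ := hs.mark u k' j (h1 ▸ hc) (h2 ▸ hm)
      exact ⟨h3, by omega⟩
    · rw [hm, hs.batch] at h3
      injection h3 with h4 h5
      exact ⟨(mem_unmarked.1 h1).2.1.trans h5.symm, Or.inr ⟨h4, h5.ge⟩⟩
    · exact absurd h1.2.2 hc
  · intro u hu hcl hc
    rw [h.frame.clean_iff] at hcl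
    have hu' := (h.blanked u hu).resolve_right fun h1 => hc h1.1
    rcases h.vertex u with ⟨h1, h2⟩ | h1 | h1
    · rw [h2]
      exact hs.dirty u hu' hcl (h1 ▸ hc)
    · exact absurd (mem_unmarked.1 h1.1).2.2 hcl
    · exact absurd h1.2.2 hc
  · intro u hc hcl
    have hne : t.level u ≠ i := fun hl => hdone ⟨u, mem_unmarked.2 ⟨hc, hl, hcl⟩⟩
    rw [h.frame.clean_iff] at hcl
    rw [h.frame.level] at hne ⊢
    rcases h.vertex u with ⟨h1, h2⟩ | h1 | h1
    · have := hs.uncolored u (h1 ▸ hc) hcl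
      omega
    · exact absurd hc h1.2.1
    · exact h1.2.1

theorem ColorInv.credit_le {B : ℕ → Batch V} {k b : ℕ} {s : Config V Δ} (hs : ColorInv B k b s)
    (u : V) : credit B s u ≤ if 6 ≤ s.level u then 27 * 3 ^ s.level u else 0 := by
  unfold credit
  cases hm : s.mark u with
  | det => simp
  | rand k' j =>
    dsimp only
    by_cases h : 6 ≤ j ∧ s.color u ≠ none ∧ ¬ AtRisk B s u k' j
    · obtain ⟨h1, -⟩ := hs.mark u k' j h.2.1 hm
      rw [if_pos h, h1, if_pos h.1]
    · rw [if_neg h]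
      exact Nat.zero_le _

/-- The vertices colored in the loop get the mark `(k, i)`, which is strictly more recent than every
random mark of a colored vertex in `s`: those come from earlier batches or from levels above `i`. So
no new risk arises for `u`. -/
theorem UnmarkedStep.vertexPot_le_of_color_eq {B : ℕ → Batch V} {k i : ℕ} {s t : Config V Δ}
    (hs : ColorInv B k (i + 1) s) (h : UnmarkedStep i s t) {u : V}
    (hc : t.color u = s.color u) (hm : t.mark u = s.mark u) :
    vertexPot B k t u ≤ vertexPot B k s u := by
  refine vertexPot_le_vertexPot hc hm fun w hd hw hwu hrec => ?_
  rcases h.vertex w with h1 | h1 | h1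
  · exact ⟨h1.1.symm, h1.2.symm⟩
  · cases hmu : s.mark u with
    | det => exact absurd hmu hd
    | rand k' j =>
      have h2 := hs.mark u k' j (by rw [← hc, ← hwu]; exact hw) hmu
      rw [hmu, h1.2.2, hs.batch] at hrec
      simp only [Mark.AtLeastAsRecent] at hrec
      omega
  · exact absurd h1.2.2 hw

/-- At the bottom level no credit is granted, nothing below can lose a credit, and the spawn cost
was booked at the beginning of the batch. -/
theorem UnmarkedStep.phasePot_le_of_le_five {B : ℕ → Batch V} {k i : ℕ} {s t : Config V Δ}
    (hs : ColorInv B k (i + 1) s) (h : UnmarkedStep i s t) (hi : i ≤ 5) :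
    phasePot B k t ≤ phasePot B k s := by
  unfold phasePot
  rw [h.frame.ccCost_eq]
  gcongr with u
  · rcases h.vertex u with h1 | h1 | h1
    · exact h.vertexPot_le_of_color_eq hs h1.1 h1.2
    · have h2 : insSince B k t u = 0 := by
        simp [insSince, h1.2.2, hs.batch, insBetween_self]
      rw [vertexPot_of_color_eq_none B k (mem_unmarked.1 h1.1).1, vertexPot, h2]
      omega
    · rw [vertexPot_of_color_eq_none B k h1.2.2, vertexPot]
      have := hs.credit_le u
      rw [if_neg (by omega)] at this
      omega
  · rcases h.vertex u with h1 | h1 | h1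
    · exact h.frame.spawnCost_le fun _ _ h2 => h1.1 ▸ h2
    · have hl := (mem_unmarked.1 h1.1).2.1
      exact h.frame.spawnCost_le fun _ h2 => by omega
    · exact h.frame.spawnCost_le fun _ _ h2 => absurd h1.2.2 h2

open Classical in
/-- The number of pairs of a vertex that was colored in the loop and a partner with its color. -/
def collisions (B : ℕ → Batch V) (k i : ℕ) (s t : Config V Δ) : ℕ :=
  ∑ u ∈ s.unmarked i, ∑ w ∈ partners B u k i,
    if t.color u ≠ none ∧ t.color w = t.color u then 1 else 0

/-- The balance of a level, in units of `9 * 3^i`. Each vertex of `H` gains `3` units of credit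
unless it collides with a partner. It spends one on its own cost and one on a vertex that it
uncolors, so one is left over; this surplus is compared with the collisions in expectation. -/
theorem UnmarkedStep.phasePot_add_le {B : ℕ → Batch V} {k i : ℕ} {s t : Config V Δ}
    (hs : ColorInv B k (i + 1) s) (h : UnmarkedStep i s t) (hi : 6 ≤ i)
    (hdone : ¬ (t.unmarked i).Nonempty) :
    phasePot B k t + 9 * 3 ^ i * (s.unmarked i).card ≤
      phasePot B k s + 27 * 3 ^ i * collisions B k i s t := by
  classical
  set H := s.unmarked i with hH
  let K : V → ℕ := fun u => ∑ w ∈ partners B u k i,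
    if t.color u ≠ none ∧ t.color w = t.color u then 1 else 0
  set A := Finset.univ.filter fun v => s.color v ≠ none ∧ t.color v = none with hA
  have hAH : A.card ≤ H.card := h.card_le.trans (Finset.card_filter_le _ _)
  have hcol : ∀ u ∈ H, t.color u ≠ none ∧ t.mark u = .rand k i := by
    intro u hu
    have hu' := mem_unmarked.1 hu
    rcases h.vertex u with h1 | h1 | h1
    · refine absurd ⟨u, mem_unmarked.2 ⟨h1.1.trans hu'.1, ?_, ?_⟩⟩ hdone
      · rw [h.frame.level]
        exact hu'.2.1
      · rw [h.frame.clean_iff]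
        exact hu'.2.2
    · exact ⟨h1.2.1, hs.batch ▸ h1.2.2⟩
    · omega
  have hpow : 3 ^ i = 3 * 3 ^ (i - 1) := by
    rw [← pow_succ']
    congr 1
    omega
  -- A vertex in `A` was at a level at most `i - 1`, so its lost credit is at most `27 * 3^(i-1) = 9
  -- * 3^i`.
  have hpt : ∀ u, vertexPot B k t u + spawnCost t u + (if u ∈ H then 27 * 3 ^ i else 0) ≤
      vertexPot B k s u + spawnCost s u +
        (if u ∈ H then 9 * 3 ^ i + 27 * 3 ^ i * K u else 0) +
        (if u ∈ A then 9 * 3 ^ i else 0) := by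
    intro u
    by_cases hu : u ∈ H
    · obtain ⟨hcu, hlu, hclu⟩ := mem_unmarked.1 hu
      obtain ⟨hct, hmt⟩ := hcol u hu
      have hcost : spawnCost t u ≤ 9 * 3 ^ i := by
        unfold spawnCost
        rw [h.frame.level, hlu]
        split_ifs with h1 h2
        · omega
        · exact (by ring : 3 ^ (i + 2) = 9 * 3 ^ i).le
        · exact Nat.zero_le _
      have hI := hs.level.pow_le u (hlu ▸ hi)
      rw [hlu] at hI
      have hpot : vertexPot B k t u + 27 * 3 ^ i ≤
          81 * insBetween B u 0 k + 27 * 3 ^ i * K u := by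
        have hsi : insSince B k t u = 0 := by
          simp [insSince, hmt, hct, insBetween_self]
        unfold vertexPot
        rw [hsi]
        by_cases hr : AtRisk B t u k i
        · obtain ⟨w, hw, hwu, -⟩ := hr
          have hK : 1 ≤ K u := by
            refine le_trans ?_ (Finset.single_le_sum (fun _ _ => Nat.zero_le _) hw)
            rw [if_pos ⟨hct, hwu⟩]
          have := Nat.mul_le_mul_left (27 * 3 ^ i) hK
          omega
        · have hcr : credit B t u = 27 * 3 ^ i := by
            simp only [credit, hmt]
            rw [if_pos ⟨hi, hct, hr⟩]
          omega
      rw [if_pos hu, if_pos hu, vertexPot_of_color_eq_none B k hcu]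
      omega
    · rw [if_neg hu, if_neg hu]
      rcases h.vertex u with h1 | h1 | h1
      · have h2 := h.vertexPot_le_of_color_eq hs h1.1 h1.2
        have h3 : spawnCost t u ≤ spawnCost s u :=
          h.frame.spawnCost_le fun _ _ h2 => h1.1 ▸ h2
        omega
      · exact absurd h1.1 hu
      · have h3 : spawnCost t u ≤ spawnCost s u :=
          h.frame.spawnCost_le fun _ _ h2 => absurd h1.2.2 h2
        rw [if_pos (Finset.mem_filter.2 ⟨Finset.mem_univ _, h1.1, h1.2.2⟩),
          vertexPot_of_color_eq_none B k h1.2.2, vertexPot]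
        have h4 : credit B s u ≤ 27 * 3 ^ (i - 1) := by
          refine (hs.credit_le u).trans ?_
          split_ifs
          · gcongr
            · norm_num
            · omega
          · exact Nat.zero_le _
        omega
  have hsum := Finset.sum_le_sum fun u (_ : u ∈ Finset.univ) => hpt u
  simp only [Finset.sum_add_distrib, Finset.sum_ite_mem, Finset.univ_inter, Finset.sum_const,
    smul_eq_mul, ← Finset.mul_sum] at hsum
  have hK : ∑ u ∈ H, K u = collisions B k i s t := rfl
  rw [hK] at hsum
  have hA' := Nat.mul_le_mul_right (9 * 3 ^ i) hAH
  unfold phasePot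
  rw [h.frame.ccCost_eq, Finset.sum_add_distrib, Finset.sum_add_distrib]
  have e1 : H.card * (27 * 3 ^ i) = 3 * (H.card * (9 * 3 ^ i)) := by ring
  have e2 : 9 * 3 ^ i * H.card = H.card * (9 * 3 ^ i) := by ring
  omega

/-! ## The coloring phase -/

/-- All vertices of `s.unmarked i` start uncolored, so each pair potential starts at no more than
`8` and stays below that in expectation, while every final collision contributes at least `m` to it.
-/
theorem expect_collisions_le {R : PaletteRule V Δ} {B : ℕ → Batch V} {k i : ℕ} {s : Config V Δ}
    (hs : ColorInv B k (i + 1) s) (hi : 5 ≤ i)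
    (hInv : ∀ t, UnmarkedStep i s t → (t.unmarked i).Nonempty →
      ∀ t' ∈ ((propose (t.unmarked i) (unmarkedPalette R i t)).map
        (commitUnmarked i t)).support, UnmarkedStep i s t') :
    3 * expect (colorUnmarked R i s) (collisions B k i s) ≤ (s.unmarked i).card := by
  classical
  set m := 3 ^ (i - 5) / 2 + 1 with hm
  let F : Config V Δ → ℕ := fun t =>
    ∑ u ∈ s.unmarked i, ∑ w ∈ partners B u k i, pairPot i m u w t
  have hF : expect (colorUnmarked R i s) F ≤ F s := by
    refine expect_whileLoop_le (Inv := UnmarkedStep i s) hInv ?_ (UnmarkedStep.refl i s)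
    intro t ht _
    simp only [F, expect_sum]
    push_cast
    refine Finset.sum_le_sum fun u hu => Finset.sum_le_sum fun w hw => ?_
    refine expect_pairPot_le R hi le_rfl ?_ ?_ ?_
    · rw [ht.frame.graph]
      exact hs.card_nbrs_le_delta
    · exact (Finset.mem_filter.1 hw).2.1
    · rw [ht.frame.level]
      exact (mem_unmarked.1 hu).2.1
  have hFs : F s ≤ ∑ u ∈ s.unmarked i, 8 * (partners B u k i).card := by
    refine Finset.sum_le_sum fun u hu => ?_
    have hcu := (mem_unmarked.1 hu).1
    calc _ ≤ ∑ w ∈ partners B u k i, 8 := by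
          refine Finset.sum_le_sum fun w _ => ?_
          unfold pairPot
          have hne : ¬ (s.color u ≠ none ∧ s.color w = s.color u) := fun h => h.1 hcu
          rw [if_pos hu, if_neg hne]
          split_ifs <;> simp
      _ = _ := by
          rw [Finset.sum_const, smul_eq_mul, mul_comm]
  have hpart : 3 * F s ≤ m * (s.unmarked i).card := by
    -- From `3^(i-5) ≤ 2 * m` and `486 = 2 * 3^5`. The cap on partners fits this: `24 / 11664 = 1 /
    -- 486`.
    have h1 : 3 ^ i ≤ 486 * m := by
      have : 3 ^ i = 243 * 3 ^ (i - 5) := by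
        rw [show (243 : ℕ) = 3 ^ 5 by norm_num, ← pow_add]
        congr 1
        omega
      omega
    calc 3 * F s ≤ 3 * ∑ u ∈ s.unmarked i, 8 * (partners B u k i).card := by gcongr
      _ ≤ ∑ u ∈ s.unmarked i, m := by
          rw [Finset.mul_sum]
          refine Finset.sum_le_sum fun u _ => ?_
          have := card_partners_le B u k i
          omega
      _ = _ := by
          rw [Finset.sum_const, smul_eq_mul, mul_comm]
  have hcoll : ∀ t, m * collisions B k i s t ≤ F t := by
    intro t
    unfold collisions
    rw [Finset.mul_sum]
    refine Finset.sum_le_sum fun u _ => ?_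
    rw [Finset.mul_sum]
    refine Finset.sum_le_sum fun w _ => ?_
    exact Nat.le_add_left _ _
  have hfin : (m : ℝ≥0∞) * (3 * expect (colorUnmarked R i s) (collisions B k i s)) ≤
      m * ((s.unmarked i).card : ℕ) := by
    calc _ = 3 * expect (colorUnmarked R i s) (fun t => m * collisions B k i s t) := by
          rw [expect_const_mul]
          ring
      _ ≤ 3 * expect (colorUnmarked R i s) F := by
          gcongr
          exact expect_mono fun t _ => hcoll t
      _ ≤ 3 * F s := by gcongr
      _ ≤ _ := by exact_mod_cast hpart
  exact (ENNReal.mul_le_mul_iff_right (by simp [hm]) (by simp)).1 hfin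

theorem colorUnmarked_spec {R : PaletteRule V Δ} {B : ℕ → Batch V} {k i : ℕ} {s : Config V Δ}
    (hs : ColorInv B k (i + 1) s) (hi : 5 ≤ i) :
    (∀ t ∈ (colorUnmarked R i s).support, ColorInv B k i t ∧ t.graph = s.graph) ∧
      expect (colorUnmarked R i s) (phasePot B k) ≤ phasePot B k s := by
  classical
  have hInv : ∀ t, UnmarkedStep i s t → (t.unmarked i).Nonempty →
      ∀ t' ∈ ((propose (t.unmarked i) (unmarkedPalette R i t)).map
        (commitUnmarked i t)).support, UnmarkedStep i s t' := by
    intro t ht _ t' ht'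
    obtain ⟨f, hf, rfl⟩ := (PMF.mem_support_map_iff _ _ _).1 ht'
    exact ht.commitUnmarked hi hs.card_nbrs_le_delta (mem_support_propose.1 hf)
  have hstep : ∀ t ∈ (colorUnmarked R i s).support, UnmarkedStep i s t :=
    whileLoop_support hInv (UnmarkedStep.refl i s)
  have hdone : ∀ t ∈ (colorUnmarked R i s).support, ¬ (t.unmarked i).Nonempty := by
    refine whileLoop_support_not_cond hInv (f := fun t => (t.unmarked i).card) (q := 3 / 4)
      ?_ ?_ ?_ (UnmarkedStep.refl i s)
    · intro t _ ht
      exact Finset.card_pos.2 ht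
    · refine ENNReal.div_lt_of_lt_mul ?_
      norm_num
    · intro t ht _
      refine expect_card_unmarked_le R hi ?_
      rw [ht.frame.graph]
      exact hs.card_nbrs_le_delta
  refine ⟨fun t ht => ⟨hs.unmarkedStep (hstep t ht) (hdone t ht), (hstep t ht).frame.graph⟩, ?_⟩
  rcases hi.eq_or_lt with h | h
  · refine (expect_mono fun t ht => (hstep t ht).phasePot_le_of_le_five hs h.ge).trans ?_
    rw [expect_const]
  · have h1 := expect_mono fun t ht =>
      (hstep t ht).phasePot_add_le hs h (hdone t ht)
    rw [expect_add, expect_add, expect_const, expect_const, expect_const_mul] at h1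
    have h2 : ((27 * 3 ^ i : ℕ) : ℝ≥0∞) * expect (colorUnmarked R i s) (collisions B k i s) ≤
        ((9 * 3 ^ i * (s.unmarked i).card : ℕ) : ℝ≥0∞) := by
      calc _ = ((9 * 3 ^ i : ℕ) : ℝ≥0∞) *
            (3 * expect (colorUnmarked R i s) (collisions B k i s)) := by
            push_cast
            ring
        _ ≤ ((9 * 3 ^ i : ℕ) : ℝ≥0∞) * ((s.unmarked i).card : ℕ) := by
            gcongr
            exact expect_collisions_le hs hi hInv
        _ = _ := by push_cast; ring
    exact (ENNReal.add_le_add_iff_right (ENNReal.natCast_ne_top _)).1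
      (h1.trans (by gcongr))

theorem colorLevel_spec {R : PaletteRule V Δ} {B : ℕ → Batch V} {k i : ℕ} {s : Config V Δ}
    (hs : ColorInv B k (i + 1) s) (hi : 5 ≤ i) :
    (∀ t ∈ ((colorMarked R i s).bind (colorUnmarked R i)).support,
      ColorInv B k i t ∧ t.graph = s.graph) ∧
      expect ((colorMarked R i s).bind (colorUnmarked R i)) (phasePot B k) ≤ phasePot B k s := by
  have h := fun r (hr : r ∈ (colorMarked R i s).support) =>
    colorUnmarked_spec (R := R) (hs.markedStep (markedStep_of_mem_support hr)) hi
  constructor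
  · intro t ht
    obtain ⟨r, hr, hrt⟩ := (PMF.mem_support_bind_iff _ _ _).1 ht
    obtain ⟨h1, h2⟩ := (h r hr).1 t hrt
    exact ⟨h1, h2.trans (markedStep_of_mem_support hr).frame.graph⟩
  · refine (expect_bind_le (f := phasePot B k) (c := 0) fun r hr => ?_).trans ?_
    · simpa using (h r hr).2
    · rw [add_zero]
      refine (expect_mono fun r hr => (markedStep_of_mem_support hr).phasePot_le).trans ?_
      rw [expect_const]

theorem colorPhase_spec {R : PaletteRule V Δ} {B : ℕ → Batch V} {k : ℕ} {s : Config V Δ}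
    (hs : ColorInv B k (numLevels Δ + 1) s) :
    (∀ t ∈ (colorPhase R s).support, ColorInv B k 5 t ∧ t.graph = s.graph) ∧
      expect (colorPhase R s) (phasePot B k) ≤ phasePot B k s := by
  have key : ∀ (n : ℕ) (s : Config V Δ), ColorInv B k (5 + n) s →
      (∀ t ∈ (forEach (fun i t => (colorMarked R i t).bind (colorUnmarked R i))
        (List.range' 5 n).reverse s).support, ColorInv B k 5 t ∧ t.graph = s.graph) ∧
      expect (forEach (fun i t => (colorMarked R i t).bind (colorUnmarked R i))
        (List.range' 5 n).reverse s) (phasePot B k) ≤ phasePot B k s := by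
    intro n
    induction n with
    | zero =>
      intro s hs
      constructor
      · intro t ht
        rw [List.range'_zero, List.reverse_nil, forEach, PMF.mem_support_pure_iff] at ht
        rw [ht]
        exact ⟨hs, rfl⟩
      · rw [List.range'_zero, List.reverse_nil, forEach, expect_pure]
    | succ n ih =>
      intro s hs
      rw [List.range'_1_concat, List.reverse_append, List.reverse_singleton,
        List.singleton_append, forEach]
      obtain ⟨h1, h2⟩ := colorLevel_spec (R := R) (i := 5 + n) hs (by omega)
      constructor
      · intro t ht
        obtain ⟨r, hr, hrt⟩ := (PMF.mem_support_bind_iff _ _ _).1 ht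
        obtain ⟨h3, h4⟩ := (ih r (h1 r hr).1).1 t hrt
        exact ⟨h3, h4.trans (h1 r hr).2⟩
      · refine (expect_bind_le (f := phasePot B k) (c := 0) fun r hr => ?_).trans ?_
        · simpa using (ih r (h1 r hr).1).2
        · simpa using h2
  refine key (numLevels Δ - 4) s ?_
  have : 5 ≤ numLevels Δ := le_max_left _ _
  rwa [show 5 + (numLevels Δ - 4) = numLevels Δ + 1 by omega]

/-! ## The moving phase -/

/-- Only dirty vertices uncolored in this batch change their level. -/
structure MoveStep (B : ℕ → Batch V) (k : ℕ) (s t : Config V Δ) : Prop where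
  graph : t.graph = s.graph
  color : t.color = s.color
  mark : t.mark = s.mark
  record : t.record = s.record
  level_eq : ∀ u, (u ∈ s.blanked → s.Clean u) → t.level u = s.level u
  level : LevelInv B k t

theorem LevelInv.move {B : ℕ → Batch V} {k : ℕ} {s t : Config V Δ} (hs : LevelInv B k s)
    (h : ∀ u, t.level u = s.level u ∨ (5 ≤ t.level u ∧ t.level u ≤ numLevels Δ ∧
      (6 ≤ t.level u → 3 ^ t.level u ≤ 3 * insBetween B u 0 k))) : LevelInv B k t := by
  refine ⟨fun u => ?_, fun u => ?_, fun u => ?_⟩ <;> rcases h u with h1 | h1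
  · exact h1 ▸ hs.five_le u
  · exact h1.1
  · exact h1 ▸ hs.le_numLevels u
  · exact h1.2.1
  · rw [h1]
    exact hs.pow_le u
  · exact h1.2.2

theorem subset_of_mem_support_sampleSubset {m : ℕ} [NeZero m] {U S : Finset V}
    (h : S ∈ (sampleSubset m U).support) : S ⊆ U := by
  classical
  obtain ⟨g, _, rfl⟩ := (PMF.mem_support_map_iff _ _ _).1 h
  exact Finset.filter_subset _ _

/-- A vertex raised to level `j` has at least `3^(j-1)` neighbors, hence at least as many
insertions, and this pays for the new level. -/
theorem MoveStep.commitRaise {B : ℕ → Batch V} {k j : ℕ} {s t : Config V Δ}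
    (hs : ∀ u, (nbrs s.graph u).card ≤ insBetween B u 0 k) (h : MoveStep B k s t)
    (hj : 5 < j) (hj' : j ≤ numLevels Δ) {S : Finset V} (hS : S ⊆ raisable j t)
    (hcand : ∀ u ∈ t.cand, u ∈ s.blanked ∧ ¬ s.Clean u) :
    MoveStep B k s (commitRaise j t S) := by
  classical
  have hlev : ∀ u, (DynColoring.commitRaise j t S).level u = t.level u ∨
      ((DynColoring.commitRaise j t S).level u = j ∧ u ∈ raisable j t) := by
    intro u
    by_cases hu : u ∈ S.filter fun u => 4 * (t.nbrsIn S u).card ≤ 3 ^ (j - 1)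
    · exact Or.inr ⟨if_pos hu, hS (Finset.mem_filter.1 hu).1⟩
    · exact Or.inl (if_neg hu)
  refine ⟨h.graph, h.color, h.mark, h.record, fun u hu => ?_, h.level.move fun u => ?_⟩
  · rcases hlev u with h1 | h1
    · rw [h1]
      exact h.level_eq u hu
    · have := hcand u (Finset.mem_filter.1 h1.2).1
      exact absurd (hu this.1) this.2
  · refine (hlev u).imp_right fun h1 => ?_
    rw [h1.1]
    refine ⟨hj.le, hj', fun _ => ?_⟩
    obtain ⟨-, h2, -⟩ := Finset.mem_filter.1 h1.2
    have h3 : 3 ^ (j - 1) ≤ insBetween B u 0 k :=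
      h2.trans ((Finset.card_le_card (nbrsUpTo_subset_nbrs t u _)).trans (h.graph ▸ hs u))
    calc 3 ^ j = 3 * 3 ^ (j - 1) := by
          rw [← pow_succ']
          congr 1
          omega
      _ ≤ _ := by gcongr

theorem MoveStep.raiseTo {B : ℕ → Batch V} {k j : ℕ} {s t : Config V Δ}
    (hs : ∀ u, (nbrs s.graph u).card ≤ insBetween B u 0 k)
    (hj : 5 < j) (hj' : j ≤ numLevels Δ)
    (h : MoveStep B k s t ∧ ∀ u, u ∈ t.cand ∨ u ∈ t.rest → u ∈ s.blanked ∧ ¬ s.Clean u) :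
    ∀ r ∈ (raiseTo j t).support,
      MoveStep B k s r ∧ ∀ u, u ∈ r.cand ∨ u ∈ r.rest → u ∈ s.blanked ∧ ¬ s.Clean u := by
  classical
  intro r hr
  obtain ⟨q, hq, rfl⟩ := (PMF.mem_support_map_iff _ _ _).1 hr
  have hq' := whileLoop_support (Inv := fun t : Config V Δ => MoveStep B k s t ∧
    ∀ u, u ∈ t.cand ∨ u ∈ t.rest → u ∈ s.blanked ∧ ¬ s.Clean u) ?_ h q hq
  · refine ⟨⟨hq'.1.graph, hq'.1.color, hq'.1.mark, hq'.1.record, hq'.1.level_eq,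
      hq'.1.level.congr rfl⟩, fun u hu => hq'.2 u ?_⟩
    rcases hu with hu | hu
    · exact Or.inr hu
    · exact absurd hu (Finset.notMem_empty u)
  · rintro t ⟨h1, h2⟩ _ t' ht'
    obtain ⟨S, hS, rfl⟩ := (PMF.mem_support_map_iff _ _ _).1 ht'
    refine ⟨h1.commitRaise hs hj hj' (subset_of_mem_support_sampleSubset hS)
      fun u hu => h2 u (Or.inl hu), fun u hu => h2 u ?_⟩
    simp only [DynColoring.commitRaise, Finset.mem_union, Finset.mem_sdiff] at hu ⊢
    rcases hu with hu | hu | hu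
    · exact Or.inl (Finset.mem_filter.1 hu.1).1
    · exact Or.inr hu
    · exact Or.inl hu.1

theorem MoveStep.raise {B : ℕ → Batch V} {k i : ℕ} {s t : Config V Δ}
    (hs : ∀ u, (nbrs s.graph u).card ≤ insBetween B u 0 k) (hi : 5 ≤ i) {U : Finset V}
    (hU : ∀ u ∈ U, u ∈ s.blanked ∧ ¬ s.Clean u) (h : MoveStep B k s t) :
    ∀ r ∈ (raise U i t).support, MoveStep B k s r := by
  classical
  intro r hr
  refine (forEach_support (Inv := fun t : Config V Δ => MoveStep B k s t ∧
    ∀ u, u ∈ t.cand ∨ u ∈ t.rest → u ∈ s.blanked ∧ ¬ s.Clean u) ?_ ?_ r hr).1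
  · intro j hj t ht
    rw [List.mem_reverse, List.mem_range'_1] at hj
    have hj₁ : 5 < j := by omega
    have hj₂ : j ≤ numLevels Δ := by omega
    exact MoveStep.raiseTo hs hj₁ hj₂ ht
  · refine ⟨⟨h.graph, h.color, h.mark, h.record, h.level_eq, h.level.congr rfl⟩,
      fun u hu => ?_⟩
    rcases hu with hu | hu
    · exact hU u (Finset.mem_filter.1 hu).1
    · exact absurd hu (Finset.notMem_empty u)

theorem MoveStep.lower {B : ℕ → Batch V} {k i : ℕ} {s t : Config V Δ} (hi : 5 ≤ i)
    {U : Finset V} (hU : ∀ u ∈ U, u ∈ s.blanked ∧ ¬ s.Clean u) (h : MoveStep B k s t) :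
    ∀ r ∈ (lower U i t).support, MoveStep B k s r := by
  classical
  intro r hr
  obtain ⟨S, hS, rfl⟩ := (PMF.mem_support_map_iff _ _ _).1 hr
  have hlev : ∀ u, (commitLower i t S).level u = t.level u ∨
      ((commitLower i t S).level u = max 5 (i - 4) ∧ u ∈ U ∧ t.level u = i) := by
    intro u
    by_cases hu : u ∈ S ∧ (t.nbrsIn S u).card ≤ 3 ^ (i - 5)
    · exact Or.inr ⟨if_pos hu, Finset.mem_filter.1 (subset_of_mem_support_sampleSubset hS hu.1)⟩
    · exact Or.inl (if_neg hu)
  refine ⟨h.graph, h.color, h.mark, h.record, fun u hu => ?_, h.level.move fun u => ?_⟩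
  · rcases hlev u with h1 | h1
    · rw [h1]
      exact h.level_eq u hu
    · have := hU u h1.2.1
      exact absurd (hu this.1) this.2
  · refine (hlev u).imp_right fun h1 => ?_
    have h2 := h.level.le_numLevels u
    rw [h1.1]
    rw [h1.2.2] at h2
    refine ⟨le_max_left _ _, by omega, fun h3 => ?_⟩
    have h4 := h.level.pow_le u (by omega)
    rw [h1.2.2] at h4
    refine le_trans ?_ h4
    gcongr
    · norm_num
    · omega

/-- The statement holds for every outcome of the sampling, so the sampling probabilities play no
role. -/
theorem moveStep_of_mem_support {B : ℕ → Batch V} {k b : ℕ} {s t : Config V Δ}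
    (hs : ColorInv B k b s) (h : t ∈ (movePhase s).support) : MoveStep B k s t := by
  classical
  obtain ⟨r, hr, hrt⟩ := (PMF.mem_support_bind_iff _ _ _).1 h
  have hmem : ∀ i ∈ levelsUp Δ, 5 ≤ i := by
    intro i hi
    rw [levelsUp, List.mem_range'_1] at hi
    exact hi.1
  refine forEach_support (fun i hi t ht => MoveStep.lower (hmem i hi) (fun u hu => ?_) ht)
    (forEach_support (fun i hi t ht => MoveStep.raise hs.card_nbrs_le
      (hmem i (List.mem_reverse.1 hi)) (fun u hu => ?_) ht)
    ⟨rfl, rfl, rfl, rfl, fun _ _ => rfl, hs.level⟩ r hr) t hrt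
  · have hu' := (Finset.mem_filter.1 hu).2.2
    exact ⟨(Finset.mem_filter.1 hu).1, fun hc => hu' hc.2⟩
  · exact ⟨(Finset.mem_filter.1 hu).1, fun hc => (Finset.mem_filter.1 hu).2 hc.1⟩

/-! ## A complete batch -/

/-- The level stored in a random mark stays correct: a moved vertex was uncolored in this batch and
dirty, so if it has a color, its mark is `det`. -/
theorem ColorInv.writeRecord {B : ℕ → Batch V} {k b : ℕ} {s t : Config V Δ}
    (hs : ColorInv B k b s) (h : MoveStep B k s t) : BatchInv B k (writeRecord s t) := by
  refine ⟨h.level.congr rfl, fun u => ?_, fun u k' i hc hm => ?_⟩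
  · have : (DynColoring.writeRecord s t).graph = s.graph := h.graph
    rw [this]
    exact hs.card_nbrs_le u
  · have hc' : s.color u ≠ none := by
      rw [← h.color]
      exact hc
    have hm' : s.mark u = .rand k' i := by
      rw [← h.mark]
      exact hm
    obtain ⟨h1, h2⟩ := hs.mark u k' i hc' hm'
    refine ⟨?_, by omega⟩
    refine (h.level_eq u fun hu => ?_).trans h1
    by_contra hcl
    have := hs.dirty u hu hcl hc'
    rw [hm'] at this
    cases this

/-- Dropping the condition on the predecessor only increases the cost; the potential pays for every
clean spawning recoloring. -/
theorem ccCostList_cons_le (τ : Timestamp) (l : List Timestamp) [Decidable τ.InC] :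
    ccCostList (τ :: l) ≤ (if τ.InC then τ.cost else 0) + ccCostList l := by
  cases l with
  | nil => simp [ccCostList]
  | cons τ' l =>
    rw [ccCostList]
    gcongr
    split_ifs with h1 h2 h2
    · exact le_rfl
    · exact absurd h1.1 h2
    · exact Nat.zero_le _
    · exact le_rfl

/-- A clean vertex at level `ℓ` has base level at most `ℓ + 2` by the upper condition and is not
moved, so its recorded cost is at most `3^(ℓ+2)`, which `spawnCost` has already booked. -/
theorem batchPot_writeRecord_le {B : ℕ → Batch V} {k : ℕ} {s t : Config V Δ}
    (hs : ColorInv B k 5 s) (h : MoveStep B k s t) :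
    batchPot B k (writeRecord s t) ≤ phasePot B k s := by
  classical
  unfold batchPot phasePot ccCost
  rw [← Finset.sum_add_distrib, ← Finset.sum_add_distrib]
  refine Finset.sum_le_sum fun u _ => ?_
  have h1 : vertexPot B k (writeRecord s t) u ≤ vertexPot B k s u := by
    refine vertexPot_le_vertexPot (congrFun h.color u) (congrFun h.mark u)
      fun w _ _ _ _ => ⟨(congrFun h.color w).symm, (congrFun h.mark w).symm⟩
  have h2 : ccCostList ((writeRecord s t).record u) ≤
      spawnCost s u + ccCostList (s.record u) := by
    by_cases hu : u ∈ s.blanked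
    · have hrec : (writeRecord s t).record u = (⟨s.batch, s.level u, s.baseLevel u, t.level u,
          s.Clean u, u ∈ s.spawned⟩ : Timestamp) :: s.record u := by
        rw [← h.record]
        exact if_pos hu
      rw [hrec]
      refine (ccCostList_cons_le _ _).trans ?_
      gcongr
      split_ifs with hC
      · obtain ⟨hcl, hsp⟩ : s.Clean u ∧ u ∈ s.spawned := hC
        have hlev := h.level_eq u fun _ => hcl
        have hbase : s.baseLevel u ≤ s.level u + 2 := by
          refine max_le ?_ (by omega)
          refine (Nat.log_mono_right hcl.1).trans ?_
          rw [Nat.log_pow (by norm_num)]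
        have hcost : 3 ^ max (s.baseLevel u) (t.level u) ≤ 3 ^ (s.level u + 2) :=
          Nat.pow_le_pow_right (by norm_num) (by omega)
        refine hcost.trans ?_
        unfold spawnCost
        rw [if_pos ⟨hsp, hcl⟩]
        by_cases hl : s.level u ≤ 5
        · rw [if_pos hl]
          exact Nat.pow_le_pow_right (by norm_num) (by omega)
        · rw [if_neg hl, if_pos]
          intro hc
          have := hs.uncolored u hc hcl
          omega
      · exact Nat.zero_le _
    · have hrec : (writeRecord s t).record u = s.record u := by
        rw [← h.record]
        exact if_neg hu
      rw [hrec]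
      exact Nat.le_add_left _ _
  omega

theorem update_spec {R : PaletteRule V Δ} {B : ℕ → Batch V} {k : ℕ} {s : Config V Δ}
    (hs : BatchInv B k s) (hB : ∀ e ∈ (B (k + 1)).ins, ¬ e.IsDiag)
    (hΔ : ∀ v, ((applyEdges s.graph (B (k + 1))).neighborSet v).ncard ≤ Δ) :
    (∀ t ∈ (update R (k + 1) (B (k + 1)) s).support,
      BatchInv B (k + 1) t ∧ t.graph = applyEdges s.graph (B (k + 1))) ∧
    expect (update R (k + 1) (B (k + 1)) s) (batchPot B (k + 1)) ≤
      batchPot B k s + 634392 * ((B (k + 1)).size : ℕ) := by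
  obtain ⟨h1, h2⟩ := colorPhase_spec (R := R) (hs.initPhase hΔ)
  constructor
  · intro t ht
    obtain ⟨r, hr, hrt⟩ := (PMF.mem_support_bind_iff _ _ _).1 ht
    obtain ⟨q, hq, rfl⟩ := (PMF.mem_support_map_iff _ _ _).1 hrt
    have hm := moveStep_of_mem_support (h1 r hr).1 hq
    exact ⟨(h1 r hr).1.writeRecord hm, hm.graph.trans (h1 r hr).2⟩
  · refine (expect_bind_le (f := phasePot B (k + 1)) (c := 0) fun r hr => ?_).trans ?_
    · rw [expect_map, add_zero]
      refine (expect_mono fun q hq => batchPot_writeRecord_le (h1 r hr).1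
        (moveStep_of_mem_support (h1 r hr).1 hq)).trans ?_
      rw [expect_const]
    · rw [add_zero]
      refine h2.trans ?_
      exact_mod_cast phasePot_initPhase_le hs hB

/-- The potential looks at future batches through `partners`. This is legitimate because the
sequence `B` is fixed before any random choice and the batches `l` are read off from it. -/
theorem expect_runFrom_le {R : PaletteRule V Δ} {B : ℕ → Batch V} (l : List (Batch V)) :
    ∀ (k : ℕ) (s : Config V Δ), BatchInv B k s → ValidFrom Δ s.graph l →
      (∀ j, (h : j < l.length) → B (k + 1 + j) = l[j]) →
      expect (runFrom R (k + 1) l s) ccCost ≤ batchPot B k s + 634392 * (totalUpdates l : ℕ) := by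
  induction l with
  | nil =>
    intro k s _ _ _
    rw [runFrom, expect_pure]
    refine le_trans ?_ le_self_add
    exact_mod_cast Nat.le_add_right _ _
  | cons S l ih =>
    intro k s hs hv hB
    have hS : B (k + 1) = S := hB 0 (by simp)
    rw [← hS] at hv ⊢
    obtain ⟨hv1, -, hv3, hv4⟩ := hv
    obtain ⟨h1, h2⟩ := update_spec (R := R) hs (fun e he => (hv1 e he).1) hv3
    rw [runFrom]
    refine (expect_bind_le (f := batchPot B (k + 1))
      (c := 634392 * (totalUpdates l : ℕ)) fun t ht => ?_).trans ?_
    · refine ih (k + 1) t (h1 t ht).1 ((h1 t ht).2 ▸ hv4) fun j hj => ?_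
      have := hB (j + 1) (by simpa using hj)
      rw [List.getElem_cons_succ] at this
      rw [← this]
      congr 1
      omega
    · refine (add_le_add_left h2 _).trans ?_
      have : totalUpdates (B (k + 1) :: l) = (B (k + 1)).size + totalUpdates l := by
        simp [totalUpdates]
      rw [this]
      push_cast
      rw [mul_add, add_assoc]

theorem batchInv_startConfig (B : ℕ → Batch V) (χ : V → Fin (Δ + 1)) :
    BatchInv B 0 (startConfig χ) := by
  refine ⟨⟨fun u => le_rfl, fun u => le_max_left _ _, fun u hu => ?_⟩, fun u => ?_, ?_⟩
  · exact absurd hu (by simp [startConfig])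
  · simp [startConfig, nbrs]
  · intro u k' i _ hm
    have h : Mark.rand 0 5 = Mark.rand k' i := hm
    injection h with h1 h2
    exact ⟨h2, h1.ge⟩

theorem batchPot_startConfig (B : ℕ → Batch V) (χ : V → Fin (Δ + 1)) :
    batchPot B 0 (startConfig χ) = 0 := by
  simp [batchPot, ccCost, startConfig, ccCostList, vertexPot, insSince, insBetween_self]

end DynColoring

/-! ### Summing over the whole run -/

theorem mainTheorem6 :
    ∃ C : ℕ, ∀ (V : Type) [Fintype V] (Δ : ℕ) (R : DynColoring.PaletteRule V Δ)
      (batches : List (DynColoring.Batch V)),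
      DynColoring.ValidFrom Δ (⊥ : SimpleGraph V) batches →
      DynColoring.expect (DynColoring.run R batches) DynColoring.ccCost
        ≤ (C : ENNReal) * (DynColoring.totalUpdates batches : ENNReal) := by
  refine ⟨634392, fun V _ Δ R batches hv => ?_⟩
  -- Batches are numbered from `1`. The value `B 0` repeats the first batch by truncated subtraction
  -- but is never counted, since all sums run over intervals `(a, b]`.
  let B : ℕ → DynColoring.Batch V := fun j => batches.getD (j - 1) ⟨∅, ∅⟩
  refine (DynColoring.expect_bind_le (f := fun _ => 0)
    (c := 634392 * (DynColoring.totalUpdates batches : ℕ)) fun χ _ => ?_).trans ?_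
  · have h := DynColoring.expect_runFrom_le (R := R) (B := B) batches 0
      (DynColoring.startConfig χ) (DynColoring.batchInv_startConfig B χ) hv (fun j hj => by
        simp [B, hj])
    rw [DynColoring.batchPot_startConfig] at h
    exact h
  · rw [DynColoring.expect_const]
    simp

end
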